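/- Let $-1<\chi<1$, $\chi\neq 0$, $c>0$ and $0<\varepsilon<1$. Let $\mathcal X=\{(f_1,f_2,f_3)\in C([0,1])^3 : f_1(0)=f_2(0)\}$ with the norm $\|(f_1,f_2,f_3)\|_\infty=\max_i\|f_i\|_\infty$ (real-valued functions). Put $$L(t,s)=-\frac{s\sin(\chi\pi)}{s^2+2ts\cos(\chi\pi)+t^2},\qquad (\mathcal L f)(s)=\int_0^1L(t,s)f(t)\,dt,\qquad \bar\Omega(s)=\begin{cases}(1-\chi)\pi,&s=0,\\ \pi,&0<s\le 1,\end{cases}$$ and let $\mathcal W(\rho_1,\rho_2,\rho_3)=\big((-\pi+\bar\Omega)\rho_1+\mathcal L\rho_2,\ \mathcal L\rho_1+(-\pi+\bar\Omega)\rho_2,\ 0\big)$. For $m\ge 1$ let $\mathcal W_m$ be given by the same formula with $\mathcal L$ replaced by $(\mathcal L_mf)(s)=\sum_{h=0}^{m+1}\lambda_hL(x_h,s)f(x_h)$ for $0<s\le1$, where $x_h$ and $\lambda_h$ are the nodes and weights of the Lobatto rule with $m+2$ points on $[0,1]$: $x_0=0$, $x_{m+1}=1$, $x_1<\dots<x_m$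 are the zeros of the polynomial of degree $m$ orthogonal on $[0,1]$ to all polynomials of lower degree with respect to the weight $v(x)=x(1-x)$, $\lambda_0=\lambda_{m+1}=\frac1{(m+1)(m+2)}$, and $\lambda_k=\int_0^1\frac{l_k(x)v(x)}{v(x_k)}\,dx$ for $1\le k\le m$, with $l_k$ the fundamental Lagrange polynomials on $x_1,\dots,x_m$. For $m\ge 1$ with $\delta_m:=c/m^{2-2\varepsilon}\le 1$ (that is, for all $m\ge1$ if $c\le 1$, and for all sufficiently large $m$ in general) define $$(\widetilde{\mathcal W}_m\rho)(s)=\begin{cases}(\mathcal W_m\rho)(s),&\delta_m\le s\le 1,\\[2pt] \delta_m^{-1}\big[s\,(\mathcal W_m\rho)(\delta_m)+(\delta_m-s)(\mathcal W\rho)(0)\big],&0\le s<\delta_m.\end{cases}$$ Then $\mathcal W$ and all these $\widetilde{\mathcal W}_m$ are bounded linear maps from $\mathcal X$ to $\mathcal X$; the limit $\lim_{m\to\infty}\|\widetilde{\mathcal W}_m\|$ of the operator norms exists and is $<\pi$; and $\lim_{m\to\infty}\|(\widetilde{\mathcal W}_m-\mathcal W)\rho\|_\infty=0$ for every $\rho\in\mathcal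 X$. -/

import Mathlib

set_option maxSynthPendingDepth 3

noncomputable section

namespace LobattoWedge

open Polynomial

/-- The Jacobi weight `v^{1,1}(x) = x (1 - x)` on `[0,1]`. -/
def jacobiWeight (x : ℝ) : ℝ := x * (1 - x)

/-- The inner product of two polynomials in `L²([0,1], v^{1,1})`. -/
def jacobiInner (p q : ℝ[X]) : ℝ :=
  ∫ x in (0 : ℝ)..1, p.eval x * q.eval x * jacobiWeight x

/-- The monic polynomials `p_0, p_1, …` (`p_m` of degree `m`) that are orthogonal on `[0,1]` with
respect to `v^{1,1}`, obtained from `1, X, X², …` by Gram-Schmidt. The normalization does not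
affect the zeros. -/
def orthoPoly (m : ℕ) : ℝ[X] :=
  X ^ m - ∑ k : Fin m,
    C (jacobiInner (X ^ m) (orthoPoly k) / jacobiInner (orthoPoly k) (orthoPoly k)) * orthoPoly k
termination_by m
decreasing_by all_goals exact k.2

/-- The interior nodes `x_1 < ⋯ < x_m` of the Lobatto rule with `m + 2` points: the zeros of
`p_m(v^{1,1})`. -/
def interiorNodes (m : ℕ) : Finset ℝ := (orthoPoly m).roots.toFinset

/-- The weight `1 / ((m + 1) (m + 2))` of the Lobatto rule at each of the end points `0`, `1`. -/
def endWeight (m : ℕ) : ℝ := 1 / (((m : ℝ) + 1) * ((m : ℝ) + 2))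

/-- The weight of the Lobatto rule at an interior node `y`: the integral over `[0,1]` of
`ℓ_y v^{1,1} / v^{1,1}(y)`, with `ℓ_y` the fundamental Lagrange polynomial of `y` based on the
interior nodes. -/
def interiorWeight (m : ℕ) (y : ℝ) : ℝ :=
  ∫ x in (0 : ℝ)..1,
    (Lagrange.basis (interiorNodes m) id y).eval x * jacobiWeight x / jacobiWeight y

/-- The Lobatto rule with `m + 2` points on `[0,1]`. -/
def lobatto (m : ℕ) (g : ℝ → ℝ) : ℝ :=
  endWeight m * g 0 + ∑ y ∈ interiorNodes m, interiorWeight m y * g y + endWeight m * g 1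

/-- The value at `s ∈ [0,1]` of a continuous function on `[0,1]`
(extended to `ℝ` by its boundary values, which are never used). -/
def val (f : C(unitInterval, ℝ)) (s : ℝ) : ℝ := Set.IccExtend zero_le_one f s

/-- The Mellin type kernel `L(t,s)`. -/
def mellinKernel (χ t s : ℝ) : ℝ :=
  -(s * Real.sin (χ * Real.pi)) / (s ^ 2 + 2 * t * s * Real.cos (χ * Real.pi) + t ^ 2)

/-- The integral operator `(𝓛 f)(s) = ∫₀¹ L(t,s) f(t) dt`. -/
def mellinOp (χ : ℝ) (f : C(unitInterval, ℝ)) (s : ℝ) : ℝ :=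
  ∫ t in (0 : ℝ)..1, mellinKernel χ t s * val f t

/-- The discretized operator `(𝓛_m f)(s) = ∑ λ_h L(x_h,s) f(x_h)`. -/
def mellinOpDiscrete (χ : ℝ) (m : ℕ) (f : C(unitInterval, ℝ)) (s : ℝ) : ℝ :=
  lobatto m fun t => mellinKernel χ t s * val f t

/-- The angle function `Ω̄₁ = Ω̄₂`, with value `(1 - χ) π` at `0` and `π` on `(0,1]`. -/
def angle (χ s : ℝ) : ℝ := if s = 0 then (1 - χ) * Real.pi else Real.pi

/-- The operator matrix with rows `((-π + Ω̄) I, A, 0)`, `(A, (-π + Ω̄) I, 0)`, `(0, 0, 0)`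
applied to the triple `ρ` and evaluated at `s`. -/
def wedgeMatrix (χ : ℝ) (A : C(unitInterval, ℝ) → ℝ → ℝ) (ρ : Fin 3 → C(unitInterval, ℝ))
    (s : ℝ) : Fin 3 → ℝ :=
  ![(-Real.pi + angle χ s) * val (ρ 0) s + A (ρ 1) s,
    A (ρ 0) s + (-Real.pi + angle χ s) * val (ρ 1) s,
    0]

/-- `(𝓦 ρ)(s)`. -/
def wedge (χ : ℝ) (ρ : Fin 3 → C(unitInterval, ℝ)) (s : ℝ) : Fin 3 → ℝ :=
  wedgeMatrix χ (mellinOp χ) ρ s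

/-- `(𝓦_m ρ)(s)`, used for `0 < s ≤ 1` only. -/
def wedgeDiscrete (χ : ℝ) (m : ℕ) (ρ : Fin 3 → C(unitInterval, ℝ)) (s : ℝ) : Fin 3 → ℝ :=
  wedgeMatrix χ (mellinOpDiscrete χ m) ρ s

/-- The break point `c / m^{2 - 2ε}`. -/
def breakPoint (c ε : ℝ) (m : ℕ) : ℝ := c / (m : ℝ) ^ (2 - 2 * ε)

/-- `(𝓦̃_m ρ)(s)`, the modified operator: `𝓦_m ρ` to the right of the break point, and the linear
interpolation between `(𝓦 ρ)(0)` and the value of `𝓦_m ρ` at the break point to its left. -/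
def wedgeModified (χ c ε : ℝ) (m : ℕ) (ρ : Fin 3 → C(unitInterval, ℝ)) (s : ℝ) : Fin 3 → ℝ :=
  if breakPoint c ε m ≤ s then wedgeDiscrete χ m ρ s
  else ((m : ℝ) ^ (2 - 2 * ε) / c) •
    (s • wedgeDiscrete χ m ρ (breakPoint c ε m) + (breakPoint c ε m - s) • wedge χ ρ 0)

/-- The space `𝓧` of triples of continuous functions on `[0,1]` with `f₁(0) = f₂(0)`; its norm is
the maximum of the sup norms of the components. -/
def spaceX : Submodule ℝ (Fin 3 → C(unitInterval, ℝ)) where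
  carrier := {f | f 0 0 = f 1 0}
  add_mem' := by
    intro a b ha hb
    simp only [Set.mem_ofPred_eq, Pi.add_apply, ContinuousMap.add_apply] at *
    rw [ha, hb]
  zero_mem' := by simp
  smul_mem' := by
    intro r a ha
    simp only [Set.mem_ofPred_eq, Pi.smul_apply, ContinuousMap.smul_apply] at *
    rw [ha]

end LobattoWedge

end

/-!
The kernel is the imaginary part of a Cauchy kernel, `L(t, s) = Im (1 / (t + s e^{iχπ}))`. Hence it
has constant sign and `∫₀¹ L(t, s) dt = arg (1 + s e^{iχπ}) - χπ` (`integral_mellinKernel`), so the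
mass of `|L(·, s)|` is at most `|χ| π`, and as `s → 0` the kernel concentrates at `0` with total mass
`-χπ` (`tendsto_mellinOp`). Together with `f₁(0) = f₂(0)` this makes `𝓦 ρ` continuous at `0`.

Everything else follows from one estimate: the error of the Lobatto rule for `L(·, s) q`, with `q` a
fixed polynomial, tends to `0` uniformly for `s ≥ c / m^{2 - 2ε}`. The rule has positive weights and
is exact on polynomials of degree at most `2 m + 1` (`lobatto_eval`), so its error is at most twice
the error of best uniform approximation (`abs_lobatto_sub_integral_le`). For exactness the
prescribed end weights have to be the right ones, which comes out of the differential equation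
`(v p_m)'' = -(m + 1) (m + 2) p_m` of the orthogonal polynomials
(`derivative_derivative_weightPoly_mul_orthoPoly`). If `a` is a pole of the kernel and `T` the
Chebyshev polynomial of degree `m` transplanted to `[0,1]`, then `(1 - T(t) / T(a)) / (t - a)` is a
polynomial that approximates `1 / (t - a)` up to `1 / (|T(a)| |t - a|)`
(`exists_polynomial_near_mellinKernel`). The point `a` has distance of order `s` from the end point
`0` of the interval, so `|T(a)|` is at least of order `exp (C m √s) ≥ exp (C' m^ε)`
(`exp_sub_one_le_poleGrowth`), which outweighs the factor `1 / |t - a| = O(m^{2 - 2ε})`.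

Since the kernel has constant sign and the weights are positive, the estimate for `q = 1` bounds
`∑ λ_h |L(x_h, s)|` by `|χ| π` plus an error that tends to `0`. This gives the upper bound for the
norm of `𝓦̃_m`, whose value at `s = 0` gives the lower bound `|χ| π`; so the limit of the norms is
`|χ| π < π`. Strong convergence to the right of the break point follows by density of polynomials,
and to its left from the continuity of `𝓦 ρ` at `0`.
-/

noncomputable section

namespace LobattoWedge

open Polynomial

/-! ### Integration of polynomials and the orthogonal polynomials -/

/-- Integration over `[0,1]` as a linear functional on polynomials. -/
def polyIntegral : ℝ[X] →ₗ[ℝ] ℝ where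
  toFun p := ∫ x in (0 : ℝ)..1, p.eval x
  map_add' p q := by
    simp only [eval_add]
    exact intervalIntegral.integral_add (p.continuous.intervalIntegrable _ _)
      (q.continuous.intervalIntegrable _ _)
  map_smul' r p := by
    simp only [eval_smul, smul_eq_mul, RingHom.id_apply]
    exact intervalIntegral.integral_const_mul _ _

lemma polyIntegral_apply (p : ℝ[X]) : polyIntegral p = ∫ x in (0 : ℝ)..1, p.eval x := rfl

/-- The Jacobi weight `X (1 - X)` as a polynomial. -/
def weightPoly : ℝ[X] := X * (1 - X)

lemma eval_weightPoly (x : ℝ) : weightPoly.eval x = jacobiWeight x := by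
  simp [weightPoly, jacobiWeight]

lemma jacobiWeight_pos {x : ℝ} (h0 : 0 < x) (h1 : x < 1) : 0 < jacobiWeight x :=
  mul_pos h0 (by linarith)

lemma jacobiWeight_nonneg {x : ℝ} (h0 : 0 ≤ x) (h1 : x ≤ 1) : 0 ≤ jacobiWeight x :=
  mul_nonneg h0 (by linarith)

lemma weightPoly_ne_zero : weightPoly ≠ 0 := by
  intro h
  have := eval_weightPoly (1 / 2)
  rw [h] at this
  norm_num [jacobiWeight] at this

lemma natDegree_weightPoly_le : weightPoly.natDegree ≤ 2 := by
  unfold weightPoly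
  compute_degree

lemma jacobiInner_eq (p q : ℝ[X]) :
    jacobiInner p q = polyIntegral (p * q * weightPoly) := by
  simp [jacobiInner, polyIntegral_apply, eval_weightPoly]

lemma jacobiInner_comm (p q : ℝ[X]) : jacobiInner p q = jacobiInner q p := by
  rw [jacobiInner_eq, jacobiInner_eq, mul_comm p q]

lemma jacobiInner_C_mul (p q : ℝ[X]) (r : ℝ) :
    jacobiInner p (C r * q) = r * jacobiInner p q := by
  rw [jacobiInner_eq, jacobiInner_eq, ← smul_eq_mul r, ← map_smul, smul_eq_C_mul]
  congr 1; ring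

lemma polyIntegral_pos {g : ℝ[X]} (hg : g ≠ 0)
    (h : ∀ x ∈ Set.Icc (0 : ℝ) 1, 0 ≤ g.eval x) : 0 < polyIntegral g := by
  obtain ⟨x, hx, hgx⟩ : ∃ x ∈ Set.Icc (0 : ℝ) 1, g.eval x ≠ 0 := by
    by_contra! hcon
    exact hg (eq_zero_of_infinite_isRoot g
      ((Set.Icc_infinite (zero_lt_one' ℝ)).mono fun x hx => hcon x hx))
  rw [polyIntegral_apply]
  exact intervalIntegral.integral_pos zero_lt_one g.continuous.continuousOn
    (fun x hx => h x (Set.Ioc_subset_Icc_self hx)) ⟨x, hx, (h x hx).lt_of_ne' hgx⟩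

/-- If `g ≥ 0` on `[0,1]`, then `g h` is not orthogonal to `h`, since their inner product is the
integral of `g h² v ≥ 0`. -/
lemma jacobiInner_mul_self_pos {g h : ℝ[X]} (hg : g ≠ 0) (hh : h ≠ 0)
    (hpos : ∀ x ∈ Set.Icc (0 : ℝ) 1, 0 ≤ g.eval x) : 0 < jacobiInner (g * h) h := by
  rw [jacobiInner_eq]
  refine polyIntegral_pos (mul_ne_zero (mul_ne_zero (mul_ne_zero hg hh) hh)
    weightPoly_ne_zero) fun x hx => ?_
  simp only [eval_mul, eval_weightPoly]
  rw [mul_assoc (eval x g)]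
  exact mul_nonneg (mul_nonneg (hpos x hx) (mul_self_nonneg _))
    (jacobiWeight_nonneg hx.1 hx.2)

lemma orthoPoly_eq (m : ℕ) : orthoPoly m = X ^ m - ∑ k ∈ Finset.range m,
    C (jacobiInner (X ^ m) (orthoPoly k) / jacobiInner (orthoPoly k) (orthoPoly k)) *
      orthoPoly k := by
  rw [orthoPoly, Finset.sum_range]

lemma monic_orthoPoly_and_natDegree (m : ℕ) :
    (orthoPoly m).Monic ∧ (orthoPoly m).natDegree = m := by
  induction m using Nat.strong_induction_on with
  | _ m ih =>
    have hdeg : (∑ k ∈ Finset.range m,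
        C (jacobiInner (X ^ m) (orthoPoly k) / jacobiInner (orthoPoly k) (orthoPoly k)) *
          orthoPoly k).degree < (m : WithBot ℕ) := by
      rw [degree_lt_iff_coeff_zero]
      intro n hn
      rw [finsetSum_coeff]
      refine Finset.sum_eq_zero fun k hk => ?_
      have hk := Finset.mem_range.1 hk
      rw [coeff_C_mul, coeff_eq_zero_of_natDegree_lt (by rw [(ih k hk).2]; omega), mul_zero]
    have hX : (X ^ m : ℝ[X]).degree = m := degree_X_pow m
    rw [orthoPoly_eq]
    refine ⟨(monic_X_pow m).sub_of_left (by rwa [hX]), ?_⟩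
    exact natDegree_eq_of_degree_eq_some (by rw [degree_sub_eq_left_of_degree_lt (by rwa [hX]), hX])

lemma monic_orthoPoly (m : ℕ) : (orthoPoly m).Monic := (monic_orthoPoly_and_natDegree m).1

lemma natDegree_orthoPoly (m : ℕ) : (orthoPoly m).natDegree = m :=
  (monic_orthoPoly_and_natDegree m).2

lemma orthoPoly_ne_zero (m : ℕ) : orthoPoly m ≠ 0 := (monic_orthoPoly m).ne_zero

lemma jacobiInner_self_pos {p : ℝ[X]} (hp : p ≠ 0) : 0 < jacobiInner p p := by
  simpa using jacobiInner_mul_self_pos (g := 1) one_ne_zero hp (by simp)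

lemma jacobiInner_orthoPoly_of_lt {m k : ℕ} (hk : k < m) :
    jacobiInner (orthoPoly m) (orthoPoly k) = 0 := by
  induction m using Nat.strong_induction_on generalizing k with
  | _ m ih =>
    rw [orthoPoly_eq m, jacobiInner_eq, sub_mul, sub_mul, map_sub, Finset.sum_mul,
      Finset.sum_mul, map_sum, Finset.sum_eq_single k]
    · rw [← jacobiInner_eq, ← jacobiInner_eq, jacobiInner_comm (C _ * _), jacobiInner_C_mul,
        div_mul_cancel₀ _ (jacobiInner_self_pos (orthoPoly_ne_zero k)).ne', sub_self]
    · intro j hj hjk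
      have hj := Finset.mem_range.1 hj
      have h0 : jacobiInner (orthoPoly k) (orthoPoly j) = 0 := by
        rcases lt_or_gt_of_ne hjk with h | h
        · exact ih k hk h
        · rw [jacobiInner_comm, ih j hj h]
      rw [← jacobiInner_eq, jacobiInner_comm (C _ * _), jacobiInner_C_mul, h0, mul_zero]
    · intro h; exact absurd (Finset.mem_range.2 hk) h

lemma jacobiInner_orthoPoly {m : ℕ} {q : ℝ[X]} (hq : q.degree < m) :
    jacobiInner (orthoPoly m) q = 0 := by
  suffices H : ∀ d ≤ m, ∀ q : ℝ[X], q.degree < d → jacobiInner (orthoPoly m) q = 0 from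
    H m le_rfl q hq
  intro d
  induction d with
  | zero =>
    intro _ q hq
    have : q = 0 := by simpa using hq
    simp [this, jacobiInner]
  | succ d ih =>
    intro hd q hq
    have h1 : (q - C (q.coeff d) * orthoPoly d).degree < d := by
      rw [degree_lt_iff_coeff_zero]
      intro n hn
      rw [coeff_sub, coeff_C_mul]
      rcases hn.eq_or_lt with rfl | h
      · have := (monic_orthoPoly d).coeff_natDegree
        rw [natDegree_orthoPoly] at this
        rw [this]; ring
      · rw [(degree_lt_iff_coeff_zero q (d + 1)).1 hq n h,
          coeff_eq_zero_of_natDegree_lt ((natDegree_orthoPoly d).trans_lt h)]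
        ring
    have h2 := ih (by omega) _ h1
    have h3 : jacobiInner (orthoPoly m) (C (q.coeff d) * orthoPoly d) = 0 := by
      rw [jacobiInner_C_mul, jacobiInner_orthoPoly_of_lt (by omega), mul_zero]
    rw [jacobiInner_eq, mul_sub, sub_mul, map_sub, ← jacobiInner_eq, ← jacobiInner_eq, h3,
      sub_zero] at h2
    exact h2

/-- Up to a constant, `orthoPoly m` is the only polynomial of degree at most `m` that is
orthogonal to all polynomials of lower degree. -/
lemma eq_C_mul_orthoPoly {m : ℕ} {u : ℝ[X]} (hu : u.natDegree ≤ m)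
    (horth : ∀ q : ℝ[X], q.degree < m → jacobiInner u q = 0) :
    u = C (u.coeff m) * orthoPoly m := by
  set r := u - C (u.coeff m) * orthoPoly m with hr
  have hdeg : r.degree < m := by
    rw [degree_lt_iff_coeff_zero]
    intro n hn
    rw [hr, coeff_sub, coeff_C_mul]
    rcases hn.eq_or_lt with rfl | h
    · have := (monic_orthoPoly m).coeff_natDegree
      rw [natDegree_orthoPoly] at this
      rw [this]; ring
    · rw [coeff_eq_zero_of_natDegree_lt (by omega),
        coeff_eq_zero_of_natDegree_lt ((natDegree_orthoPoly m).trans_lt h)]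
      ring
  have h0 : jacobiInner r r = 0 := by
    have h1 := horth r hdeg
    have h2 := jacobiInner_orthoPoly hdeg
    rw [jacobiInner_comm] at h1 h2
    have h3 : jacobiInner r (C (u.coeff m) * orthoPoly m) = 0 := by
      rw [jacobiInner_C_mul, h2, mul_zero]
    conv_lhs => rw [jacobiInner_eq]; enter [2, 1, 2]; rw [hr]
    rw [mul_sub, sub_mul, map_sub, ← jacobiInner_eq, ← jacobiInner_eq, h1, h3, sub_zero]
  by_contra hne
  exact (jacobiInner_self_pos (sub_ne_zero.2 hne)).ne' h0

/-- `orthoPoly m` has no factor of positive degree that is nonnegative on `[0,1]`. -/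
lemma not_dvd_orthoPoly_of_nonneg {m : ℕ} {g : ℝ[X]} (hg : g.natDegree ≠ 0)
    (hpos : ∀ x ∈ Set.Icc (0 : ℝ) 1, 0 ≤ g.eval x) : ¬ g ∣ orthoPoly m := by
  rintro ⟨h, hh⟩
  have hne := orthoPoly_ne_zero m
  rw [hh] at hne
  have hg0 := left_ne_zero_of_mul hne
  have hh0 := right_ne_zero_of_mul hne
  have hdeg : g.natDegree + h.natDegree = m := by
    rw [← natDegree_mul hg0 hh0, ← hh, natDegree_orthoPoly]
  have h1 := jacobiInner_mul_self_pos hg0 hh0 hpos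
  rw [← hh, jacobiInner_orthoPoly] at h1
  · exact lt_irrefl _ h1
  · rw [degree_eq_natDegree hh0]
    exact_mod_cast (by omega : h.natDegree < m)

lemma orthoPoly_root_mem {m : ℕ} {a : ℝ} (ha : (orthoPoly m).IsRoot a) :
    a ∈ Set.Ioo (0 : ℝ) 1 := by
  have hdvd := dvd_iff_isRoot.2 ha
  by_contra hcon
  rw [Set.mem_Ioo, not_and_or, not_lt, not_lt] at hcon
  rcases hcon with h | h
  · refine not_dvd_orthoPoly_of_nonneg (by simp) (fun x hx => ?_) hdvd
    simp only [eval_sub, eval_X, eval_C]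
    linarith [hx.1]
  · refine not_dvd_orthoPoly_of_nonneg (g := -(X - C a)) ?_ (fun x hx => ?_)
      (neg_dvd.2 hdvd)
    · rw [natDegree_neg, natDegree_X_sub_C]; exact one_ne_zero
    · simp only [eval_neg, eval_sub, eval_X, eval_C]
      linarith [hx.2]

lemma orthoPoly_roots_nodup (m : ℕ) : (orthoPoly m).roots.Nodup := by
  classical
  rw [Multiset.nodup_iff_count_le_one]
  intro a
  rw [count_roots]
  by_contra! hcon
  refine not_dvd_orthoPoly_of_nonneg (g := (X - C a) ^ 2) (by simp) (fun x _ => ?_)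
    ((le_rootMultiplicity_iff (orthoPoly_ne_zero m)).1 hcon)
  simp only [eval_pow]
  positivity

lemma splits_orthoPoly (m : ℕ) : (orthoPoly m).Splits := by
  obtain ⟨g, hg, hcard, hroots⟩ := exists_prod_multiset_X_sub_C_mul (orthoPoly m)
  have hdvd : g ∣ orthoPoly m := Dvd.intro_left _ hg
  have hg0 : g ≠ 0 := ne_zero_of_dvd_ne_zero (orthoPoly_ne_zero m) hdvd
  rw [splits_iff_card_roots]
  by_contra hdeg
  have hnat : g.natDegree ≠ 0 := by omega
  have hnr : ∀ x, g.eval x ≠ 0 := fun x hx => by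
    have : x ∈ g.roots := (mem_roots hg0).2 hx
    simp [hroots] at this
  -- A factor without real zeros has constant sign.
  rcases lt_or_gt_of_ne (hnr 0) with h0 | h0
  · refine not_dvd_orthoPoly_of_nonneg (g := -g) (by rwa [natDegree_neg]) (fun x hx => ?_)
      (neg_dvd.2 hdvd)
    rw [eval_neg]
    by_contra! hlt
    obtain ⟨y, -, hy⟩ := intermediate_value_Icc hx.1 g.continuous.continuousOn
      ⟨h0.le, by linarith⟩
    exact hnr y hy
  · refine not_dvd_orthoPoly_of_nonneg hnat (fun x hx => ?_) hdvd
    by_contra! hlt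
    obtain ⟨y, -, hy⟩ := intermediate_value_Icc' hx.1 g.continuous.continuousOn
      ⟨hlt.le, h0.le⟩
    exact hnr y hy

lemma mem_interiorNodes {m : ℕ} {y : ℝ} :
    y ∈ interiorNodes m ↔ (orthoPoly m).eval y = 0 := by
  rw [interiorNodes, Multiset.mem_toFinset, mem_roots (orthoPoly_ne_zero m), IsRoot.def]

lemma interiorNodes_subset {m : ℕ} {y : ℝ} (hy : y ∈ interiorNodes m) :
    y ∈ Set.Ioo (0 : ℝ) 1 :=
  orthoPoly_root_mem (mem_interiorNodes.1 hy)

lemma card_interiorNodes (m : ℕ) : (interiorNodes m).card = m := by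
  rw [interiorNodes, Multiset.toFinset_card_of_nodup (orthoPoly_roots_nodup m),
    splits_iff_card_roots.1 (splits_orthoPoly m), natDegree_orthoPoly]

lemma orthoPoly_dvd_of_eval_eq_zero {m : ℕ} {f : ℝ[X]}
    (hf : ∀ y ∈ interiorNodes m, f.eval y = 0) : orthoPoly m ∣ f := by
  rcases eq_or_ne f 0 with rfl | hf0
  · exact dvd_zero _
  refine ((splits_orthoPoly m).dvd_iff_roots_le_roots (orthoPoly_ne_zero m)  hf0).2 ?_
  rw [Multiset.le_iff_subset (orthoPoly_roots_nodup m)]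
  intro y hy
  rw [mem_roots hf0]
  exact hf y (by simpa [interiorNodes] using hy)

/-! ### Exactness and positivity of the Lobatto rule -/

lemma polyIntegral_derivative (f : ℝ[X]) :
    polyIntegral (derivative f) = f.eval 1 - f.eval 0 := by
  rw [polyIntegral_apply]
  exact intervalIntegral.integral_eq_sub_of_hasDerivAt (fun x _ => f.hasDerivAt x)
    ((derivative f).continuous.intervalIntegrable _ _)

lemma eval_weightPoly_zero : weightPoly.eval 0 = 0 := by simp [weightPoly]

lemma eval_weightPoly_one : weightPoly.eval 1 = 0 := by simp [weightPoly]

/-- The differential equation of the orthogonal polynomials: two integrations by parts show that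
`(v p_m)''` is again orthogonal to all polynomials of degree less than `m`. -/
lemma derivative_derivative_weightPoly_mul_orthoPoly (m : ℕ) :
    derivative (derivative (weightPoly * orthoPoly m)) =
      C (-(((m : ℝ) + 1) * ((m : ℝ) + 2))) * orthoPoly m := by
  set p := orthoPoly m with hp
  have hcoeff : (weightPoly * p).coeff (m + 2) = -1 := by
    have h1 := (monic_orthoPoly m).coeff_natDegree
    rw [natDegree_orthoPoly] at h1
    have h2 : p.coeff (m + 1) = 0 :=
      coeff_eq_zero_of_natDegree_lt (by rw [hp, natDegree_orthoPoly]; omega)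
    rw [weightPoly, mul_assoc, coeff_X_mul, sub_mul, one_mul, coeff_sub, coeff_X_mul, h2, h1]
    ring
  have hdeg : (derivative (derivative (weightPoly * p))).natDegree ≤ m := by
    have h1 : (weightPoly * p).natDegree ≤ m + 2 := by
      refine natDegree_mul_le.trans ?_
      rw [hp, natDegree_orthoPoly]
      have := natDegree_weightPoly_le
      omega
    have h2 := natDegree_derivative_le (weightPoly * p)
    have h3 := natDegree_derivative_le (derivative (weightPoly * p))
    omega
  have key := eq_C_mul_orthoPoly hdeg ?_
  · rw [key, coeff_derivative, coeff_derivative, hcoeff]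
    congr 2
    push_cast
    ring
  intro q hq
  have hid : derivative (derivative (weightPoly * p)) * q * weightPoly
      = derivative (derivative (weightPoly * p) * (q * weightPoly)
          - (weightPoly * p) * derivative (q * weightPoly))
        + p * derivative (derivative (q * weightPoly)) * weightPoly := by
    simp only [derivative_mul, derivative_sub, derivative_add]
    ring
  rw [jacobiInner_eq, hid, map_add, polyIntegral_derivative, ← jacobiInner_eq,
    jacobiInner_orthoPoly]
  · simp [eval_weightPoly_zero, eval_weightPoly_one]
  · rw [degree_lt_iff_coeff_zero]
    intro n hn
    have hqd : (q * weightPoly).coeff (n + 1 + 1) = 0 := by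
      refine coeff_eq_zero_of_degree_lt (degree_mul_le _ _ |>.trans_lt ?_)
      have h2 : weightPoly.degree ≤ ((2 : ℕ) : WithBot ℕ) :=
        natDegree_le_iff_degree_le.1 natDegree_weightPoly_le
      rcases eq_or_ne q 0 with rfl | hq0
      · simp only [degree_zero, WithBot.bot_add]
        exact WithBot.bot_lt_coe _
      · rw [degree_eq_natDegree hq0] at hq ⊢
        have hq' : q.natDegree < m := by exact_mod_cast hq
        calc (q.natDegree : WithBot ℕ) + weightPoly.degree
            ≤ (q.natDegree : WithBot ℕ) + ((2 : ℕ) : WithBot ℕ) := by gcongr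
          _ < ((n + 1 + 1 : ℕ) : WithBot ℕ) := by
              exact_mod_cast (by omega : q.natDegree + 2 < n + 1 + 1)
    rw [coeff_derivative, coeff_derivative, hqd]
    ring

lemma polyIntegral_mul_orthoPoly_eq (m : ℕ) (f : ℝ[X]) :
    polyIntegral (f * orthoPoly m) = -endWeight m *
      polyIntegral (f * derivative (derivative (weightPoly * orthoPoly m))) := by
  have hK : ((m : ℝ) + 1) * ((m : ℝ) + 2) ≠ 0 := by positivity
  rw [derivative_derivative_weightPoly_mul_orthoPoly,
    show f * (C (-(((m : ℝ) + 1) * ((m : ℝ) + 2))) * orthoPoly m)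
      = (-(((m : ℝ) + 1) * ((m : ℝ) + 2))) • (f * orthoPoly m) by
        rw [smul_eq_C_mul]; ring,
    map_smul, smul_eq_mul, endWeight]
  field_simp

lemma polyIntegral_one_sub_X_mul_orthoPoly (m : ℕ) :
    polyIntegral ((1 - X) * orthoPoly m) = endWeight m * (orthoPoly m).eval 0 := by
  rw [polyIntegral_mul_orthoPoly_eq]
  set p := orthoPoly m
  have hid : (1 - X) * derivative (derivative (weightPoly * p))
      = derivative ((1 - X) * derivative (weightPoly * p) + weightPoly * p) := by
    simp only [derivative_mul, derivative_sub, derivative_add, derivative_X, derivative_one]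
    ring
  rw [hid, polyIntegral_derivative]
  simp [weightPoly, derivative_mul]

lemma polyIntegral_X_mul_orthoPoly (m : ℕ) :
    polyIntegral (X * orthoPoly m) = endWeight m * (orthoPoly m).eval 1 := by
  rw [polyIntegral_mul_orthoPoly_eq]
  set p := orthoPoly m
  have hid : X * derivative (derivative (weightPoly * p))
      = derivative (X * derivative (weightPoly * p) - weightPoly * p) := by
    simp only [derivative_mul, derivative_sub, derivative_add, derivative_X]
    ring
  rw [hid, polyIntegral_derivative]
  simp [weightPoly, derivative_mul]

lemma interiorWeight_eq (m : ℕ) (y : ℝ) : interiorWeight m y =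
    polyIntegral (Lagrange.basis (interiorNodes m) id y * weightPoly) / jacobiWeight y := by
  rw [interiorWeight, intervalIntegral.integral_div, polyIntegral_apply]
  simp only [eval_mul, eval_weightPoly]

lemma natDegree_lagrange_basis_interiorNodes {m : ℕ} {y : ℝ} (hy : y ∈ interiorNodes m) :
    (Lagrange.basis (interiorNodes m) id y).natDegree = m - 1 := by
  rw [Lagrange.natDegree_basis Function.injective_id.injOn hy, card_interiorNodes]

lemma eval_lagrange_basis_interiorNodes {m : ℕ} {y z : ℝ} (hy : y ∈ interiorNodes m)
    (hz : z ∈ interiorNodes m) :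
    (Lagrange.basis (interiorNodes m) id y).eval z = if z = y then 1 else 0 := by
  split_ifs with h
  · subst h
    exact Lagrange.eval_basis_self (v := id) Function.injective_id.injOn hz
  · exact Lagrange.eval_basis_of_ne (v := id) (Ne.symm h) hz

/-- A polynomial of degree less than `2 m` that vanishes at the interior nodes has weighted
integral `0`, because it is a multiple of `orthoPoly m`. -/
lemma polyIntegral_mul_weightPoly_eq_zero {m : ℕ} {f : ℝ[X]} (hdeg : f.degree < (2 * m : ℕ))
    (hf : ∀ y ∈ interiorNodes m, f.eval y = 0) : polyIntegral (f * weightPoly) = 0 := by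
  obtain ⟨r, rfl⟩ := orthoPoly_dvd_of_eval_eq_zero hf
  rw [← jacobiInner_eq]
  rcases eq_or_ne r 0 with rfl | hr
  · simp [jacobiInner]
  refine jacobiInner_orthoPoly ?_
  rw [degree_mul, degree_eq_natDegree (orthoPoly_ne_zero m), degree_eq_natDegree hr,
    natDegree_orthoPoly] at hdeg
  rw [degree_eq_natDegree hr]
  have : m + r.natDegree < 2 * m := by exact_mod_cast hdeg
  exact_mod_cast (by omega : r.natDegree < m)

lemma interiorWeight_pos {m : ℕ} {y : ℝ} (hy : y ∈ interiorNodes m) :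
    0 < interiorWeight m y := by
  have hw := jacobiWeight_pos (interiorNodes_subset hy).1 (interiorNodes_subset hy).2
  rw [interiorWeight_eq]
  refine div_pos ?_ hw
  set l := Lagrange.basis (interiorNodes m) id y with hl
  have hl0 : l ≠ 0 := Lagrange.basis_ne_zero Function.injective_id.injOn hy
  have hm : 1 ≤ m := by
    rw [← card_interiorNodes m]
    exact Finset.card_pos.2 ⟨y, hy⟩
  have hld : l.natDegree = m - 1 := natDegree_lagrange_basis_interiorNodes hy
  -- `l² - l` vanishes at the nodes, so `l` and `l²` have the same weighted integral.
  have h0 : polyIntegral ((l * l - l) * weightPoly) = 0 := by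
    refine polyIntegral_mul_weightPoly_eq_zero (m := m) ?_ fun z hz => ?_
    · have h1 : (l * l - l).natDegree ≤ 2 * (m - 1) := by
        refine (natDegree_sub_le _ _).trans (max_le (natDegree_mul_le.trans ?_) ?_) <;> omega
      have h2 : (l * l - l).natDegree < 2 * m := by omega
      exact degree_le_natDegree.trans_lt (by exact_mod_cast h2)
    · rw [eval_sub, eval_mul, hl, eval_lagrange_basis_interiorNodes hy hz]
      split_ifs <;> ring
  rw [sub_mul, map_sub, sub_eq_zero] at h0
  rw [← h0, ← jacobiInner_eq]
  exact jacobiInner_self_pos hl0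

lemma sum_interiorWeight_mul_jacobiWeight {m : ℕ} {f : ℝ[X]} (hdeg : f.degree < (2 * m : ℕ)) :
    ∑ y ∈ interiorNodes m, interiorWeight m y * (jacobiWeight y * f.eval y)
      = polyIntegral (f * weightPoly) := by
  set g : ℝ[X] := ∑ y ∈ interiorNodes m, f.eval y • Lagrange.basis (interiorNodes m) id y with hg
  have hgd : g.degree < (2 * m : ℕ) := by
    rw [degree_lt_iff_coeff_zero]
    intro n hn
    rw [hg, finsetSum_coeff]
    refine Finset.sum_eq_zero fun y hy => ?_
    have hm : 1 ≤ m := by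
      rw [← card_interiorNodes m]
      exact Finset.card_pos.2 ⟨y, hy⟩
    rw [coeff_smul, coeff_eq_zero_of_natDegree_lt, smul_zero]
    rw [natDegree_lagrange_basis_interiorNodes hy]
    omega
  have h0 : polyIntegral ((f - g) * weightPoly) = 0 := by
    refine polyIntegral_mul_weightPoly_eq_zero
      ((degree_sub_le _ _).trans_lt (max_lt hdeg hgd)) fun z hz => ?_
    rw [eval_sub, hg, eval_finsetSum, Finset.sum_eq_single z]
    · rw [eval_smul, eval_lagrange_basis_interiorNodes hz hz]
      simp
    · intro y hy hne
      rw [eval_smul, eval_lagrange_basis_interiorNodes hy hz, if_neg hne.symm, smul_zero]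
    · exact fun h => absurd hz h
  rw [sub_mul, map_sub, sub_eq_zero] at h0
  rw [h0, hg, Finset.sum_mul, map_sum]
  refine Finset.sum_congr rfl fun y hy => ?_
  have hw := jacobiWeight_pos (interiorNodes_subset hy).1 (interiorNodes_subset hy).2
  rw [smul_mul_assoc, map_smul, smul_eq_mul, interiorWeight_eq]
  field_simp

lemma lobatto_add (m : ℕ) (f g : ℝ → ℝ) :
    lobatto m (fun x => f x + g x) = lobatto m f + lobatto m g := by
  simp only [lobatto, mul_add, Finset.sum_add_distrib]
  ring

lemma lobatto_sub (m : ℕ) (f g : ℝ → ℝ) :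
    lobatto m (fun x => f x - g x) = lobatto m f - lobatto m g := by
  simp only [lobatto, mul_sub, Finset.sum_sub_distrib]
  ring

lemma lobatto_const_mul (m : ℕ) (r : ℝ) (f : ℝ → ℝ) :
    lobatto m (fun x => r * f x) = r * lobatto m f := by
  simp only [lobatto, mul_add, Finset.mul_sum]
  congr 1
  · congr 1
    · ring
    · exact Finset.sum_congr rfl fun y _ => by ring
  · ring

lemma lobatto_mul_orthoPoly (m : ℕ) (f : ℝ[X]) :
    lobatto m (fun x => (f * orthoPoly m).eval x) =
      endWeight m * (f * orthoPoly m).eval 0 + endWeight m * (f * orthoPoly m).eval 1 := by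
  rw [lobatto, Finset.sum_eq_zero, add_zero]
  intro y hy
  rw [eval_mul, mem_interiorNodes.1 hy, mul_zero, mul_zero]

/-- The Lobatto rule with `m + 2` points is exact on polynomials of degree at most `2 m + 1`.
Such a polynomial is a combination of `(1 - X) p_m`, `X p_m` and a multiple of `X (1 - X)`; the
prescribed end weights enter through the first two. -/
theorem lobatto_eval {m : ℕ} {f : ℝ[X]} (hf : f.natDegree ≤ 2 * m + 1) :
    lobatto m (fun x => f.eval x) = polyIntegral f := by
  have hp0 : (orthoPoly m).eval 0 ≠ 0 := fun h => lt_irrefl _ (orthoPoly_root_mem h).1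
  have hp1 : (orthoPoly m).eval 1 ≠ 0 := fun h => lt_irrefl _ (orthoPoly_root_mem h).2
  set a := f.eval 0 / (orthoPoly m).eval 0 with ha
  set b := f.eval 1 / (orthoPoly m).eval 1 with hb
  set r := f - a • ((1 - X) * orthoPoly m) - b • (X * orthoPoly m) with hr
  have hr0 : r.eval 0 = 0 := by
    simp [hr, ha, div_mul_cancel₀ _ hp0]
  have hr1 : r.eval 1 = 0 := by
    simp [hr, hb, div_mul_cancel₀ _ hp1]
  have hrdeg : r.natDegree ≤ 2 * m + 1 := by
    have h1 : ((1 - X) * orthoPoly m).natDegree ≤ 2 * m + 1 := by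
      refine natDegree_mul_le.trans ?_
      have : (1 - X : ℝ[X]).natDegree ≤ 1 := by compute_degree
      rw [natDegree_orthoPoly]; omega
    have h2 : (X * orthoPoly m).natDegree ≤ 2 * m + 1 := by
      refine natDegree_mul_le.trans ?_
      rw [natDegree_orthoPoly, natDegree_X]; omega
    exact (natDegree_sub_le _ _).trans (max_le ((natDegree_sub_le _ _).trans
      (max_le hf ((natDegree_smul_le _ _).trans h1))) ((natDegree_smul_le _ _).trans h2))
  obtain ⟨q, hq⟩ : ∃ q, r = q * weightPoly := by
    obtain ⟨q₁, hq₁⟩ := dvd_iff_isRoot.2 (show r.IsRoot 0 from hr0)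
    have hq₁1 : q₁.IsRoot 1 := by simpa [hq₁] using hr1
    obtain ⟨q₂, hq₂⟩ := dvd_iff_isRoot.2 hq₁1
    refine ⟨-q₂, ?_⟩
    rw [hq₁, hq₂, weightPoly]
    simp only [C_0, C_1]
    ring
  have hqdeg : q.degree < (2 * m : ℕ) := by
    rcases eq_or_ne q 0 with rfl | hq0
    · rw [degree_zero]; exact WithBot.bot_lt_coe _
    have hw : weightPoly.natDegree = 2 := by
      refine le_antisymm natDegree_weightPoly_le (le_natDegree_of_ne_zero ?_)
      simp [weightPoly, coeff_X_mul, coeff_one, coeff_X]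
    rw [hq, natDegree_mul hq0 weightPoly_ne_zero, hw] at hrdeg
    rw [degree_eq_natDegree hq0]
    exact_mod_cast (by omega : q.natDegree < 2 * m)
  have hlr : lobatto m (fun x => r.eval x) = polyIntegral r := by
    rw [hq, ← sum_interiorWeight_mul_jacobiWeight hqdeg, lobatto]
    simp only [eval_mul, eval_weightPoly_zero, eval_weightPoly_one, mul_zero, zero_add,
      add_zero]
    refine Finset.sum_congr rfl fun y _ => ?_
    rw [eval_weightPoly, mul_comm (eval y q)]
  have hfe : f = r + (a • ((1 - X) * orthoPoly m) + b • (X * orthoPoly m)) := by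
    rw [hr]; ring
  have hsplit : (fun x => f.eval x) = fun x => r.eval x +
      (a * ((1 - X) * orthoPoly m).eval x + b * (X * orthoPoly m).eval x) := by
    funext x
    conv_lhs => rw [hfe]
    simp only [eval_add, eval_smul, smul_eq_mul]
  rw [hsplit, lobatto_add, lobatto_add, lobatto_const_mul, lobatto_const_mul, hlr,
    lobatto_mul_orthoPoly, lobatto_mul_orthoPoly]
  conv_rhs => rw [hfe]
  rw [map_add, map_add, map_smul, map_smul, polyIntegral_one_sub_X_mul_orthoPoly,
    polyIntegral_X_mul_orthoPoly]
  simp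

lemma endWeight_pos (m : ℕ) : 0 < endWeight m := by
  unfold endWeight; positivity

lemma lobatto_mono {m : ℕ} {f g : ℝ → ℝ} (h : ∀ x ∈ Set.Icc (0 : ℝ) 1, f x ≤ g x) :
    lobatto m f ≤ lobatto m g := by
  unfold lobatto
  have hsum : ∑ y ∈ interiorNodes m, interiorWeight m y * f y ≤
      ∑ y ∈ interiorNodes m, interiorWeight m y * g y :=
    Finset.sum_le_sum fun y hy => mul_le_mul_of_nonneg_left
      (h y (Set.Ioo_subset_Icc_self (interiorNodes_subset hy))) (interiorWeight_pos hy).le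
  have h0 := mul_le_mul_of_nonneg_left (h 0 (by simp)) (endWeight_pos m).le
  have h1 := mul_le_mul_of_nonneg_left (h 1 (by simp)) (endWeight_pos m).le
  linarith

lemma lobatto_const (m : ℕ) (r : ℝ) : lobatto m (fun _ => r) = r := by
  have := lobatto_eval (m := m) (f := C r) (by simp)
  simpa [polyIntegral_apply] using this

lemma abs_lobatto_le {m : ℕ} {f g : ℝ → ℝ} (h : ∀ x ∈ Set.Icc (0 : ℝ) 1, |f x| ≤ g x) :
    |lobatto m f| ≤ lobatto m g := by
  have h1 : lobatto m f ≤ lobatto m g := lobatto_mono fun x hx => (le_abs_self _).trans (h x hx)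
  have h2 : lobatto m (fun x => -1 * f x) ≤ lobatto m g :=
    lobatto_mono fun x hx => by linarith [neg_abs_le (f x), h x hx]
  rw [lobatto_const_mul] at h2
  exact abs_le.2 ⟨by linarith, h1⟩

/-- The error of the Lobatto rule is at most twice the error of uniform approximation by
polynomials of degree at most `2 m + 1`. -/
lemma abs_lobatto_sub_integral_le {m : ℕ} {g : ℝ → ℝ} {f : ℝ[X]} {η : ℝ}
    (hf : f.natDegree ≤ 2 * m + 1) (hg : IntervalIntegrable g MeasureTheory.volume 0 1)
    (h : ∀ x ∈ Set.Icc (0 : ℝ) 1, |g x - f.eval x| ≤ η) :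
    |lobatto m g - ∫ x in (0 : ℝ)..1, g x| ≤ 2 * η := by
  have h1 : |lobatto m g - polyIntegral f| ≤ η := by
    rw [← lobatto_eval hf, ← lobatto_sub]
    exact (abs_lobatto_le h).trans_eq (lobatto_const m η)
  have h2 : |(∫ x in (0 : ℝ)..1, g x) - polyIntegral f| ≤ η := by
    rw [polyIntegral_apply, ← intervalIntegral.integral_sub hg
      (f.continuous.intervalIntegrable _ _)]
    have := intervalIntegral.norm_integral_le_of_norm_le_const (a := (0 : ℝ)) (b := 1) (C := η)
      (f := fun x => g x - f.eval x) fun x hx => by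
        rw [Set.uIoc_of_le zero_le_one] at hx
        exact h x (Set.Ioc_subset_Icc_self hx)
    simpa using this
  have := abs_sub_le (lobatto m g) (polyIntegral f) (∫ x in (0 : ℝ)..1, g x)
  rw [abs_sub_comm (polyIntegral f)] at this
  linarith

/-! ### Growth of the Chebyshev polynomials off the interval -/

/-- The Chebyshev polynomials under the Joukowski map `z ↦ (z + z⁻¹) / 2`. -/
lemma eval_chebyshevT_joukowski {z : ℂ} (hz : z ≠ 0) (n : ℕ) :
    (Chebyshev.T ℂ n).eval ((z + z⁻¹) / 2) = (z ^ n + (z ^ n)⁻¹) / 2 := by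
  have h := Chebyshev.T_complex_cosh (Complex.log z) n
  have h1 : Complex.exp ((n : ℂ) * Complex.log z) = z ^ n := by
    rw [Complex.exp_nat_mul, Complex.exp_log hz]
  rw [Complex.cosh, Complex.cosh, Complex.exp_neg, Complex.exp_neg, Complex.exp_log hz] at h
  rw [h]
  push_cast
  rw [h1]

/-- Lower bound for the Chebyshev polynomials near the end point `1`: they grow geometrically at
`1 + 2 b²` with a ratio that exceeds `1` by an amount linear in `re b`, that is, by the square root
of the distance to the interval. -/
lemma le_norm_eval_chebyshevT {b : ℂ} (hb : 0 ≤ b.re) (n : ℕ) :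
    ((1 + b.re) ^ (2 * n) - 1) / 2 ≤ ‖(Chebyshev.T ℂ n).eval (1 + 2 * b ^ 2)‖ := by
  obtain ⟨z, hz1, hzb⟩ : ∃ z : ℂ, 1 ≤ ‖z‖ ∧ z - z⁻¹ = 2 * b := by
    obtain ⟨w, hw⟩ := IsAlgClosed.exists_pow_nat_eq (b ^ 2 + 1) zero_lt_two
    -- The zeros of `z² - 2 b z - 1` have product `-1`, so one of them has modulus at least `1`.
    have hprod : (b + w) * (w - b) = 1 := by linear_combination hw
    have hinv : (b + w)⁻¹ = w - b := (eq_inv_of_mul_eq_one_right hprod).symm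
    have hne : b + w ≠ 0 := left_ne_zero_of_mul_eq_one hprod
    rcases le_total 1 ‖b + w‖ with h | h
    · exact ⟨b + w, h, by rw [hinv]; ring⟩
    · refine ⟨b - w, ?_, ?_⟩
      · rw [← norm_neg, neg_sub, ← hinv, norm_inv]
        exact (one_le_inv₀ (norm_pos_iff.2 hne)).2 h
      · have : (b - w)⁻¹ = -(b + w) := by
          rw [← neg_sub w b, ← hinv, inv_neg, inv_inv]
        rw [this]; ring
  have hr0 : 0 < ‖z‖ := by linarith
  have hz0 : z ≠ 0 := norm_pos_iff.1 hr0
  have harg : (1 + 2 * b ^ 2 : ℂ) = (z ^ 2 + (z ^ 2)⁻¹) / 2 := by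
    have : b = (z - z⁻¹) / 2 := by rw [hzb]; ring
    rw [this]
    field_simp
    ring
  have hre : 1 + b.re ≤ ‖z‖ := by
    have h1 : 2 * b.re = z.re * (1 - (‖z‖ ^ 2)⁻¹) := by
      have := congrArg Complex.re hzb
      rw [Complex.sub_re, Complex.inv_re, Complex.normSq_eq_norm_sq] at this
      simp only [Complex.mul_re, Complex.re_ofNat, Complex.im_ofNat] at this
      rw [div_eq_mul_inv] at this
      linear_combination -this
    have h2 : 0 ≤ 1 - (‖z‖ ^ 2)⁻¹ :=
      sub_nonneg.2 (inv_le_one_of_one_le₀ (one_le_pow₀ hz1))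
    have h3 : 2 * b.re ≤ ‖z‖ * (1 - (‖z‖ ^ 2)⁻¹) := by
      rw [h1]
      exact mul_le_mul_of_nonneg_right (Complex.re_le_norm z) h2
    have h4 : ‖z‖ * (1 - (‖z‖ ^ 2)⁻¹) = ‖z‖ - ‖z‖⁻¹ := by
      field_simp
    have h5 : 2 - ‖z‖ ≤ ‖z‖⁻¹ := by
      rw [← sub_nonneg]
      have : ‖z‖⁻¹ - (2 - ‖z‖) = (‖z‖ - 1) ^ 2 * ‖z‖⁻¹ := by field_simp; ring
      rw [this]
      positivity
    linarith
  rw [harg, eval_chebyshevT_joukowski (pow_ne_zero 2 hz0), norm_div, ← pow_mul]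
  have hpow : (1 + b.re) ^ (2 * n) ≤ ‖z‖ ^ (2 * n) := pow_le_pow_left₀ (by linarith) hre _
  have hinv : (‖z‖ ^ (2 * n))⁻¹ ≤ 1 := inv_le_one_of_one_le₀ (one_le_pow₀ hz1)
  have htri := norm_sub_norm_le (z ^ (2 * n)) (-(z ^ (2 * n))⁻¹)
  rw [sub_neg_eq_add, norm_neg, norm_inv, norm_pow] at htri
  rw [show ‖(2 : ℂ)‖ = 2 by simp]
  linarith

/-! ### Polynomial approximation of the kernel -/

/-- The point `s e^{iχπ}`; its negative and the conjugate of that are the poles of the kernel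
`L(·, s)`. -/
def kernelPole (χ s : ℝ) : ℂ := s * Complex.exp ((χ * Real.pi : ℝ) * Complex.I)

lemma kernelPole_re (χ s : ℝ) : (kernelPole χ s).re = s * Real.cos (χ * Real.pi) := by
  rw [kernelPole, Complex.re_ofReal_mul, Complex.exp_ofReal_mul_I_re]

lemma kernelPole_im (χ s : ℝ) : (kernelPole χ s).im = s * Real.sin (χ * Real.pi) := by
  rw [kernelPole, Complex.im_ofReal_mul, Complex.exp_ofReal_mul_I_im]

/-- The kernel is the imaginary part of a Cauchy kernel. -/
lemma mellinKernel_eq_im (χ t s : ℝ) :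
    mellinKernel χ t s = ((t + kernelPole χ s : ℂ)⁻¹).im := by
  rw [Complex.inv_im, Complex.normSq_apply, mellinKernel]
  simp only [Complex.add_re, Complex.add_im, Complex.ofReal_re, Complex.ofReal_im,
    kernelPole_re, kernelPole_im, zero_add]
  congr 1
  linear_combination (-s ^ 2) * Real.sin_sq_add_cos_sq (χ * Real.pi)

lemma sin_chi_ne_zero {χ : ℝ} (h1 : -1 < χ) (h2 : χ < 1) (h0 : χ ≠ 0) :
    Real.sin (χ * Real.pi) ≠ 0 := by
  have hpi := Real.pi_pos
  rw [Ne, Real.sin_eq_zero_iff_of_lt_of_lt (by nlinarith) (by nlinarith)]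
  exact mul_ne_zero h0 hpi.ne'

lemma abs_le_norm_add_kernelPole (χ t s : ℝ) :
    |s * Real.sin (χ * Real.pi)| ≤ ‖(t + kernelPole χ s : ℂ)‖ := by
  have := Complex.abs_im_le_norm (t + kernelPole χ s : ℂ)
  simpa [kernelPole_im] using this

lemma add_kernelPole_ne_zero {χ s : ℝ} (hsin : Real.sin (χ * Real.pi) ≠ 0) (hs : 0 < s) (t : ℝ) :
    (t + kernelPole χ s : ℂ) ≠ 0 := by
  refine norm_pos_iff.1 (lt_of_lt_of_le ?_ (abs_le_norm_add_kernelPole χ t s))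
  exact abs_pos.2 (mul_ne_zero hs.ne' hsin)

lemma exists_real_polynomial_eval_eq_im (f : ℂ[X]) :
    ∃ g : ℝ[X], g.natDegree ≤ f.natDegree ∧ ∀ t : ℝ, g.eval t = (f.eval (t : ℂ)).im := by
  refine ⟨∑ i ∈ Finset.range (f.natDegree + 1), C (f.coeff i).im * X ^ i, ?_, fun t => ?_⟩
  · refine natDegree_sum_le_of_forall_le _ _ fun i hi => ?_
    exact (natDegree_C_mul_X_pow_le _ _).trans (Nat.lt_succ_iff.1 (Finset.mem_range.1 hi))
  · rw [eval_finsetSum, eval_eq_sum_range (p := f), Complex.im_sum]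
    refine Finset.sum_congr rfl fun i _ => ?_
    rw [← Complex.ofReal_pow, Complex.im_mul_ofReal]
    simp

/-- A lower bound for the modulus of the shifted Chebyshev polynomial of degree `m` at the poles of
`L(·, s)`. -/
def poleGrowth (χ : ℝ) (m : ℕ) (s : ℝ) : ℝ :=
  ((1 + Real.sqrt s * Real.cos (χ * Real.pi / 2)) ^ (2 * m) - 1) / 2

lemma cos_half_pos {χ : ℝ} (h1 : -1 < χ) (h2 : χ < 1) : 0 < Real.cos (χ * Real.pi / 2) := by
  have hpi := Real.pi_pos
  exact Real.cos_pos_of_mem_Ioo ⟨by nlinarith, by nlinarith⟩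

/-- If `a` is the pole of `1 / (t - a)` and `T` the shifted Chebyshev polynomial of degree `m`, then
`(1 - T(t) / T(a)) / (t - a)` is a polynomial which differs from `1 / (t - a)` by
`T(t) / (T(a) (t - a))`. -/
lemma exists_polynomial_near_mellinKernel {χ s : ℝ} (h1 : -1 < χ) (h2 : χ < 1) (h0 : χ ≠ 0)
    (hs : 0 < s) {m : ℕ} (hm : 0 < poleGrowth χ m s) :
    ∃ f : ℝ[X], f.natDegree ≤ m ∧ ∀ t ∈ Set.Icc (0 : ℝ) 1,
      |mellinKernel χ t s - f.eval t| ≤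
        1 / (s * |Real.sin (χ * Real.pi)| * poleGrowth χ m s) := by
  have hsin := sin_chi_ne_zero h1 h2 h0
  set a : ℂ := -kernelPole χ s with ha
  set b : ℂ := Real.sqrt s * Complex.exp ((χ * Real.pi / 2 : ℝ) * Complex.I) with hb
  have hbre : b.re = Real.sqrt s * Real.cos (χ * Real.pi / 2) := by
    rw [hb, Complex.re_ofReal_mul, Complex.exp_ofReal_mul_I_re]
  have hb2 : b ^ 2 = kernelPole χ s := by
    rw [hb, mul_pow, ← Complex.ofReal_pow, Real.sq_sqrt hs.le, ← Complex.exp_nat_mul, kernelPole]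
    congr 2
    push_cast
    ring
  set τ : ℂ := (Chebyshev.T ℂ m).eval (1 - 2 * a) with hτ
  have hτle : poleGrowth χ m s ≤ ‖τ‖ := by
    have := le_norm_eval_chebyshevT (b := b)
      (by rw [hbre]; exact mul_nonneg (Real.sqrt_nonneg _) (cos_half_pos h1 h2).le) m
    rw [hbre] at this
    rw [hτ, ha, ← hb2, show 1 - 2 * -b ^ 2 = 1 + 2 * b ^ 2 by ring]
    exact this
  have hτ0 : τ ≠ 0 := norm_pos_iff.1 (hm.trans_le hτle)
  set p : ℂ[X] := 1 - C τ⁻¹ * (Chebyshev.T ℂ m).comp (1 - C 2 * X) with hp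
  have hpev : ∀ x : ℂ, p.eval x = 1 - τ⁻¹ * (Chebyshev.T ℂ m).eval (1 - 2 * x) := by
    intro x; simp [hp, eval_comp]
  have hroot : p.IsRoot a := by
    rw [IsRoot.def, hpev, ← hτ, inv_mul_cancel₀ hτ0, sub_self]
  obtain ⟨q, hq⟩ := dvd_iff_isRoot.2 hroot
  have hpdeg : p.natDegree ≤ m := by
    have hlin : (1 - C 2 * X : ℂ[X]).natDegree ≤ 1 := by compute_degree
    refine (natDegree_sub_le _ _).trans (max_le (by simp) ((natDegree_C_mul_le _ _).trans ?_))
    rw [natDegree_comp, Chebyshev.natDegree_T, Int.natAbs_natCast]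
    exact (Nat.mul_le_mul_left m hlin).trans (by omega)
  have hqdeg : q.natDegree ≤ m := by
    rcases eq_or_ne q 0 with rfl | hq0
    · simp
    · rw [hq, natDegree_mul (X_sub_C_ne_zero a) hq0, natDegree_X_sub_C] at hpdeg
      omega
  obtain ⟨f, hfdeg, hf⟩ := exists_real_polynomial_eval_eq_im q
  refine ⟨f, hfdeg.trans hqdeg, fun t ht => ?_⟩
  have hta : (t + kernelPole χ s : ℂ) ≠ 0 := add_kernelPole_ne_zero hsin hs t
  have hdiff : (t + kernelPole χ s : ℂ)⁻¹ - q.eval (t : ℂ) =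
      (Chebyshev.T ℂ m).eval (1 - 2 * (t : ℂ)) / (τ * (t + kernelPole χ s)) := by
    have h3 := hpev t
    rw [hq, eval_mul, eval_sub, eval_X, eval_C, ha, sub_neg_eq_add] at h3
    field_simp
    field_simp at h3
    linear_combination -h3
  have hT : ‖(Chebyshev.T ℂ m).eval (1 - 2 * (t : ℂ))‖ ≤ 1 := by
    have h3 : (1 - 2 * (t : ℂ)) = ((1 - 2 * t : ℝ) : ℂ) := by push_cast; rfl
    rw [h3, ← Chebyshev.complex_ofReal_eval_T, Complex.norm_real]
    exact Chebyshev.abs_eval_T_real_le_one m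
      (abs_le.2 ⟨by linarith [ht.2], by linarith [ht.1]⟩)
  rw [mellinKernel_eq_im, hf, ← Complex.sub_im, hdiff]
  refine (Complex.abs_im_le_norm _).trans ?_
  rw [norm_div, norm_mul]
  have hn := abs_le_norm_add_kernelPole χ t s
  rw [abs_mul, abs_of_pos hs] at hn
  have hspos : 0 < s * |Real.sin (χ * Real.pi)| := mul_pos hs (abs_pos.2 hsin)
  refine div_le_div₀ zero_le_one hT (mul_pos hspos hm) ?_
  rw [mul_comm ‖τ‖]
  exact mul_le_mul hn hτle hm.le (norm_nonneg _)

/-! ### The quadrature error for the kernel -/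

lemma kernel_denom_pos {χ s : ℝ} (hsin : Real.sin (χ * Real.pi) ≠ 0) (hs : 0 < s) (t : ℝ) :
    0 < s ^ 2 + 2 * t * s * Real.cos (χ * Real.pi) + t ^ 2 := by
  have h : s ^ 2 + 2 * t * s * Real.cos (χ * Real.pi) + t ^ 2 =
      (t + s * Real.cos (χ * Real.pi)) ^ 2 + (s * Real.sin (χ * Real.pi)) ^ 2 := by
    linear_combination (-s ^ 2) * Real.sin_sq_add_cos_sq (χ * Real.pi)
  rw [h]
  have := mul_ne_zero hs.ne' hsin
  positivity

lemma continuous_mellinKernel_left {χ s : ℝ} (hsin : Real.sin (χ * Real.pi) ≠ 0) (hs : 0 < s) :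
    Continuous fun t => mellinKernel χ t s := by
  unfold mellinKernel
  exact Continuous.div (by fun_prop) (by fun_prop) fun t => (kernel_denom_pos hsin hs t).ne'

lemma exp_half_le_one_add {x : ℝ} (h0 : 0 ≤ x) (h1 : x ≤ 1) : Real.exp (x / 2) ≤ 1 + x := by
  refine (Real.exp_bound_div_one_sub_of_interval (by linarith) (by linarith)).trans ?_
  rw [div_le_iff₀ (by linarith)]
  nlinarith

lemma breakPoint_pos {c ε : ℝ} (hc : 0 < c) {m : ℕ} (hm : 1 ≤ m) : 0 < breakPoint c ε m := by
  have : (0 : ℝ) < m := by exact_mod_cast hm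
  unfold breakPoint
  positivity

/-- Bound for the error of approximation of `L(·, s)` by polynomials of degree `m`, uniform for `s`
to the right of the break point. -/
def kernelError (χ c ε : ℝ) (m : ℕ) : ℝ :=
  2 / (breakPoint c ε m * |Real.sin (χ * Real.pi)| *
    (Real.exp (Real.sqrt c * Real.cos (χ * Real.pi / 2) * (m : ℝ) ^ ε) - 1))

/-- The poles for `s = c / m^{2 - 2ε}` have distance of order `m^{-2 + 2ε}` from the interval, and
the Chebyshev polynomial of degree `m` is there of order `exp (C m^ε)`. -/
lemma exp_sub_one_le_poleGrowth {χ c ε s : ℝ} (h1 : -1 < χ) (h2 : χ < 1)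
    (hc : 0 < c) {m : ℕ} (hm : 1 ≤ m) (hs : breakPoint c ε m ≤ s) (hs1 : s ≤ 1) :
    (Real.exp (Real.sqrt c * Real.cos (χ * Real.pi / 2) * (m : ℝ) ^ ε) - 1) / 2 ≤
      poleGrowth χ m s := by
  have hκ := cos_half_pos h1 h2
  have hm0 : (0 : ℝ) < m := by exact_mod_cast hm
  set κ := Real.cos (χ * Real.pi / 2)
  have hδ := breakPoint_pos (ε := ε) hc hm
  have hsq : Real.sqrt c * (m : ℝ) ^ ε = m * Real.sqrt (breakPoint c ε m) := by
    rw [breakPoint, Real.sqrt_div hc.le, Real.sqrt_eq_rpow ((m : ℝ) ^ (2 - 2 * ε)),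
      ← Real.rpow_mul hm0.le, show (2 - 2 * ε) * (1 / 2) = 1 - ε by ring,
      Real.rpow_sub hm0, Real.rpow_one]
    field_simp
  have hβ0 : 0 ≤ Real.sqrt s * κ := mul_nonneg (Real.sqrt_nonneg _) hκ.le
  have hβ1 : Real.sqrt s * κ ≤ 1 :=
    mul_le_one₀ (Real.sqrt_le_one.2 hs1) hκ.le (Real.cos_le_one _)
  have h3 : Real.exp (Real.sqrt c * κ * (m : ℝ) ^ ε) ≤ (1 + Real.sqrt s * κ) ^ (2 * m) := by
    calc Real.exp (Real.sqrt c * κ * (m : ℝ) ^ ε)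
        = Real.exp (m * (Real.sqrt (breakPoint c ε m) * κ)) := by
          congr 1; linear_combination κ * hsq
      _ ≤ Real.exp (m * (Real.sqrt s * κ)) := by gcongr
      _ = Real.exp (Real.sqrt s * κ / 2) ^ (2 * m) := by
          rw [← Real.exp_nat_mul]; congr 1; push_cast; ring
      _ ≤ (1 + Real.sqrt s * κ) ^ (2 * m) := by
          gcongr; exact exp_half_le_one_add hβ0 hβ1
  unfold poleGrowth
  linarith

lemma exp_sub_one_pos {χ c ε : ℝ} (h1 : -1 < χ) (h2 : χ < 1) (hc : 0 < c) {m : ℕ} (hm : 1 ≤ m) :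
    0 < Real.exp (Real.sqrt c * Real.cos (χ * Real.pi / 2) * (m : ℝ) ^ ε) - 1 := by
  have hκ := cos_half_pos h1 h2
  have hm0 : (0 : ℝ) < m := by exact_mod_cast hm
  have := Real.add_one_lt_exp
    (x := Real.sqrt c * Real.cos (χ * Real.pi / 2) * (m : ℝ) ^ ε) (by positivity)
  have : 0 < Real.sqrt c * Real.cos (χ * Real.pi / 2) * (m : ℝ) ^ ε := by positivity
  linarith

lemma kernelError_nonneg {χ c ε : ℝ} (h1 : -1 < χ) (h2 : χ < 1) (hc : 0 < c) {m : ℕ}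
    (hm : 1 ≤ m) : 0 ≤ kernelError χ c ε m := by
  have := exp_sub_one_pos (ε := ε) h1 h2 hc hm
  have := breakPoint_pos (ε := ε) hc hm
  unfold kernelError
  positivity

lemma abs_lobatto_mellinKernel_mul_sub_le {χ c ε s M : ℝ} (h1 : -1 < χ) (h2 : χ < 1) (h0 : χ ≠ 0)
    (hc : 0 < c) {m : ℕ} (hm : 1 ≤ m) (hs : breakPoint c ε m ≤ s) (hs1 : s ≤ 1)
    {q : ℝ[X]} (hq : q.natDegree ≤ m) (hM : ∀ t ∈ Set.Icc (0 : ℝ) 1, |q.eval t| ≤ M) :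
    |lobatto m (fun t => mellinKernel χ t s * q.eval t) -
      ∫ t in (0 : ℝ)..1, mellinKernel χ t s * q.eval t| ≤ 2 * (kernelError χ c ε m * M) := by
  have hsin := sin_chi_ne_zero h1 h2 h0
  have hδ := breakPoint_pos (ε := ε) hc hm
  have hs0 : 0 < s := hδ.trans_le hs
  have hE := exp_sub_one_pos (ε := ε) h1 h2 hc hm
  have hg := exp_sub_one_le_poleGrowth h1 h2 hc hm hs hs1
  obtain ⟨f, hfdeg, hf⟩ := exists_polynomial_near_mellinKernel h1 h2 h0 hs0
    (lt_of_lt_of_le (by linarith) hg : 0 < poleGrowth χ m s)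
  refine abs_lobatto_sub_integral_le (f := f * q)
    (natDegree_mul_le.trans (by omega)) ?_ fun t ht => ?_
  · exact ((continuous_mellinKernel_left hsin hs0).mul q.continuous).intervalIntegrable _ _
  · rw [eval_mul, ← sub_mul, abs_mul]
    refine mul_le_mul ((hf t ht).trans ?_) (hM t ht) (abs_nonneg _)
      (kernelError_nonneg h1 h2 hc hm)
    have hden : breakPoint c ε m * |Real.sin (χ * Real.pi)| *
        ((Real.exp (Real.sqrt c * Real.cos (χ * Real.pi / 2) * (m : ℝ) ^ ε) - 1) / 2) ≤
        s * |Real.sin (χ * Real.pi)| * poleGrowth χ m s := by gcongr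
    have hpos : 0 < breakPoint c ε m * |Real.sin (χ * Real.pi)| *
        ((Real.exp (Real.sqrt c * Real.cos (χ * Real.pi / 2) * (m : ℝ) ^ ε) - 1) / 2) := by
      have := abs_pos.2 hsin
      positivity
    refine (one_div_le_one_div_of_le hpos hden).trans_eq ?_
    rw [kernelError]
    have := abs_pos.2 hsin
    field_simp

lemma tendsto_kernelError {χ c ε : ℝ} (h1 : -1 < χ) (h2 : χ < 1) (h0 : χ ≠ 0)
    (hc : 0 < c) (hε : 0 < ε) (hε' : ε < 1) :
    Filter.Tendsto (kernelError χ c ε) Filter.atTop (nhds 0) := by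
  have hκ := cos_half_pos h1 h2
  have hsin := abs_pos.2 (sin_chi_ne_zero h1 h2 h0)
  set K := Real.sqrt c * Real.cos (χ * Real.pi / 2) with hK
  have hK0 : 0 < K := by positivity
  have hx : Filter.Tendsto (fun m : ℕ => (m : ℝ) ^ ε) Filter.atTop Filter.atTop :=
    (tendsto_rpow_atTop hε).comp tendsto_natCast_atTop_atTop
  have hexp := (tendsto_exp_mul_div_rpow_atTop ((2 - 2 * ε) / ε) K hK0).comp hx
  have hlow : Filter.Tendsto (fun m : ℕ => breakPoint c ε m * |Real.sin (χ * Real.pi)| *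
      (Real.exp (K * (m : ℝ) ^ ε) - 1)) Filter.atTop Filter.atTop := by
    have h3 := (Filter.tendsto_atTop_add_const_right _ (-1 : ℝ) hexp).const_mul_atTop
      (mul_pos hc hsin)
    refine Filter.tendsto_atTop_mono' _ ?_ h3
    filter_upwards [Filter.eventually_ge_atTop 1] with m hm
    have hm0 : (1 : ℝ) ≤ m := by exact_mod_cast hm
    have hpow : ((m : ℝ) ^ ε) ^ ((2 - 2 * ε) / ε) = (m : ℝ) ^ (2 - 2 * ε) := by
      rw [← Real.rpow_mul (by linarith), mul_div_cancel₀ _ hε.ne']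
    have hone : 1 ≤ (m : ℝ) ^ (2 - 2 * ε) := Real.one_le_rpow hm0 (by linarith)
    simp only [Function.comp_apply, hpow]
    rw [breakPoint]
    have h4 : 1 / (m : ℝ) ^ (2 - 2 * ε) ≤ 1 := by
      rw [div_le_one (by linarith)]; exact hone
    have h5 : c / (m : ℝ) ^ (2 - 2 * ε) * |Real.sin (χ * Real.pi)| *
        (Real.exp (K * (m : ℝ) ^ ε) - 1) = c * |Real.sin (χ * Real.pi)| *
        (Real.exp (K * (m : ℝ) ^ ε) / (m : ℝ) ^ (2 - 2 * ε) - 1 / (m : ℝ) ^ (2 - 2 * ε)) := by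
      ring
    rw [h5]
    refine mul_le_mul_of_nonneg_left ?_ (by positivity)
    linarith
  exact hlow.const_div_atTop 2

/-! ### The mass of the kernel -/

/-- Since `L(·, s)` is the imaginary part of a Cauchy kernel, its integral is a difference of
arguments. -/
lemma integral_mellinKernel {χ s : ℝ} (h1 : -1 < χ) (h2 : χ < 1) (h0 : χ ≠ 0) (hs : 0 < s) :
    ∫ t in (0 : ℝ)..1, mellinKernel χ t s =
      Complex.arg (1 + kernelPole χ s) - χ * Real.pi := by
  have hsin := sin_chi_ne_zero h1 h2 h0
  have hpi := Real.pi_pos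
  have hd : ∀ t : ℝ, HasDerivAt (fun t : ℝ => (Complex.log (t + kernelPole χ s)).im)
      (mellinKernel χ t s) t := by
    intro t
    have h3 : HasDerivAt (fun t : ℝ => (t + kernelPole χ s : ℂ)) 1 t :=
      (Complex.ofRealCLM.hasDerivAt (x := t)).add_const _
    have h4 := h3.clog_real (x := t) (Or.inr (by
      simp only [Complex.add_im, Complex.ofReal_im, kernelPole_im, zero_add]
      exact mul_ne_zero hs.ne' hsin))
    have h5 := Complex.imCLM.hasFDerivAt.comp_hasDerivAt t h4
    rw [mellinKernel_eq_im, ← one_div]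
    exact h5
  rw [intervalIntegral.integral_eq_sub_of_hasDerivAt (fun t _ => hd t)
    ((continuous_mellinKernel_left hsin hs).intervalIntegrable _ _)]
  simp only [Complex.log_im, Complex.ofReal_zero, Complex.ofReal_one, zero_add]
  congr 1
  rw [kernelPole, Complex.arg_real_mul _ hs, Complex.exp_mul_I, ← Complex.ofReal_cos,
    ← Complex.ofReal_sin]
  have := Complex.arg_cos_add_sin_mul_I (θ := χ * Real.pi) ⟨by nlinarith, by nlinarith⟩
  rwa [← Complex.ofReal_cos, ← Complex.ofReal_sin] at this

/-- The kernel has constant sign, opposite to that of `χ`. -/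
lemma abs_mellinKernel {χ : ℝ} (h1 : -1 < χ) (h2 : χ < 1) (h0 : χ ≠ 0) {s : ℝ} (hs : 0 < s)
    (t : ℝ) : |mellinKernel χ t s| = -(SignType.sign χ : ℝ) * mellinKernel χ t s := by
  have hpi := Real.pi_pos
  have hden := kernel_denom_pos (sin_chi_ne_zero h1 h2 h0) hs t
  rcases lt_or_gt_of_ne h0 with h | h
  · have hsin : Real.sin (χ * Real.pi) < 0 :=
      Real.sin_neg_of_neg_of_neg_pi_lt (by nlinarith) (by nlinarith)
    rw [sign_neg h, abs_of_nonneg]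
    · simp
    · exact div_nonneg (by nlinarith) hden.le
  · have hsin : 0 < Real.sin (χ * Real.pi) :=
      Real.sin_pos_of_pos_of_lt_pi (by nlinarith) (by nlinarith)
    rw [sign_pos h, abs_of_nonpos]
    · simp
    · exact div_nonpos_of_nonpos_of_nonneg (by nlinarith) hden.le

lemma sign_mul_arg_nonneg {χ : ℝ} (h1 : -1 < χ) (h2 : χ < 1) (h0 : χ ≠ 0) {s : ℝ} (hs : 0 < s) :
    0 ≤ (SignType.sign χ : ℝ) * Complex.arg (1 + kernelPole χ s) := by
  have hpi := Real.pi_pos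
  have him : (1 + kernelPole χ s).im = s * Real.sin (χ * Real.pi) := by
    simp [kernelPole_im]
  rcases lt_or_gt_of_ne h0 with h | h
  · have hsin : Real.sin (χ * Real.pi) < 0 :=
      Real.sin_neg_of_neg_of_neg_pi_lt (by nlinarith) (by nlinarith)
    have : Complex.arg (1 + kernelPole χ s) < 0 :=
      Complex.arg_neg_iff.2 (by rw [him]; nlinarith)
    rw [sign_neg h]
    simpa using this.le
  · have hsin : 0 < Real.sin (χ * Real.pi) :=
      Real.sin_pos_of_pos_of_lt_pi (by nlinarith) (by nlinarith)
    rw [sign_pos h]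
    simpa using Complex.arg_nonneg_iff.2 (by rw [him]; positivity :
      0 ≤ (1 + kernelPole χ s).im)

lemma neg_sign_mul_integral_mellinKernel_le {χ : ℝ} (h1 : -1 < χ) (h2 : χ < 1) (h0 : χ ≠ 0)
    {s : ℝ} (hs : 0 < s) :
    -(SignType.sign χ : ℝ) * ∫ t in (0 : ℝ)..1, mellinKernel χ t s ≤ |χ| * Real.pi := by
  rw [integral_mellinKernel h1 h2 h0 hs]
  have := sign_mul_arg_nonneg h1 h2 h0 hs
  have h3 := sign_mul_self χ
  linear_combination this + Real.pi * h3

lemma integral_abs_mellinKernel_le {χ : ℝ} (h1 : -1 < χ) (h2 : χ < 1) (h0 : χ ≠ 0)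
    {s : ℝ} (hs : 0 < s) :
    ∫ t in (0 : ℝ)..1, |mellinKernel χ t s| ≤ |χ| * Real.pi := by
  simp_rw [abs_mellinKernel h1 h2 h0 hs]
  rw [intervalIntegral.integral_const_mul]
  exact neg_sign_mul_integral_mellinKernel_le h1 h2 h0 hs

lemma abs_integral_mellinKernel_mul_le {χ : ℝ} (h1 : -1 < χ) (h2 : χ < 1) (h0 : χ ≠ 0)
    {s : ℝ} (hs : 0 < s) {f : ℝ → ℝ} (hf : Continuous f) {M : ℝ}
    (hM : ∀ t ∈ Set.Icc (0 : ℝ) 1, |f t| ≤ M) :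
    |∫ t in (0 : ℝ)..1, mellinKernel χ t s * f t| ≤ |χ| * Real.pi * M := by
  have hM0 : 0 ≤ M := (abs_nonneg _).trans (hM 0 (by simp))
  have hc := continuous_mellinKernel_left (sin_chi_ne_zero h1 h2 h0) hs
  calc |∫ t in (0 : ℝ)..1, mellinKernel χ t s * f t|
      ≤ ∫ t in (0 : ℝ)..1, |mellinKernel χ t s * f t| :=
        intervalIntegral.abs_integral_le_integral_abs zero_le_one
    _ ≤ ∫ t in (0 : ℝ)..1, |mellinKernel χ t s| * M := by
        refine intervalIntegral.integral_mono_on zero_le_one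
          ((hc.mul hf).abs.intervalIntegrable _ _)
          ((hc.abs.mul continuous_const).intervalIntegrable _ _) fun t ht => ?_
        rw [abs_mul]
        exact mul_le_mul_of_nonneg_left (hM t ht) (abs_nonneg _)
    _ ≤ |χ| * Real.pi * M := by
        rw [intervalIntegral.integral_mul_const]
        exact mul_le_mul_of_nonneg_right (integral_abs_mellinKernel_le h1 h2 h0 hs) hM0

lemma abs_lobatto_mellinKernel_mul_le {χ c ε s M : ℝ} (h1 : -1 < χ) (h2 : χ < 1) (h0 : χ ≠ 0)
    (hc : 0 < c) {m : ℕ} (hm : 1 ≤ m) (hs : breakPoint c ε m ≤ s) (hs1 : s ≤ 1)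
    {f : ℝ → ℝ} (hM : ∀ t ∈ Set.Icc (0 : ℝ) 1, |f t| ≤ M) :
    |lobatto m (fun t => mellinKernel χ t s * f t)| ≤
      (|χ| * Real.pi + 2 * kernelError χ c ε m) * M := by
  have hM0 : 0 ≤ M := (abs_nonneg _).trans (hM 0 (by simp))
  have hs0 : 0 < s := (breakPoint_pos hc hm).trans_le hs
  have h3 : |lobatto m (fun t => mellinKernel χ t s * f t)| ≤
      lobatto m (fun t => (-(SignType.sign χ : ℝ) * M) * mellinKernel χ t s) := by
    refine abs_lobatto_le fun t ht => ?_
    rw [abs_mul, mul_right_comm, ← abs_mellinKernel h1 h2 h0 hs0]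
    exact mul_le_mul_of_nonneg_left (hM t ht) (abs_nonneg _)
  have h4 := abs_lobatto_mellinKernel_mul_sub_le (M := 1) h1 h2 h0 hc hm hs hs1
    (q := (1 : ℝ[X])) (by simp) (by simp)
  simp only [eval_one, mul_one] at h4
  have h5 := neg_sign_mul_integral_mellinKernel_le h1 h2 h0 hs0
  have h6 : |-(SignType.sign χ : ℝ)| = 1 := by
    rcases lt_or_gt_of_ne h0 with h | h
    · simp [sign_neg h]
    · simp [sign_pos h]
  have h7 : -(SignType.sign χ : ℝ) * (lobatto m (fun t => mellinKernel χ t s) -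
      ∫ t in (0 : ℝ)..1, mellinKernel χ t s) ≤ 2 * kernelError χ c ε m := by
    refine (le_abs_self _).trans ?_
    rw [abs_mul, h6, one_mul]
    exact h4
  rw [lobatto_const_mul] at h3
  refine h3.trans ?_
  rw [mul_right_comm]
  refine mul_le_mul_of_nonneg_right ?_ hM0
  linarith

/-! ### The Mellin operator and its discretization -/

lemma continuous_val (f : C(unitInterval, ℝ)) : Continuous (val f) :=
  f.continuous.Icc_extend'

lemma val_coe (f : C(unitInterval, ℝ)) (s : unitInterval) : val f s = f s :=
  Set.IccExtend_val _ _ _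

lemma val_zero (f : C(unitInterval, ℝ)) : val f 0 = f 0 := val_coe f 0

lemma abs_val_le (f : C(unitInterval, ℝ)) (s : ℝ) : |val f s| ≤ ‖f‖ :=
  f.norm_coe_le_norm _

lemma val_add (f g : C(unitInterval, ℝ)) (s : ℝ) : val (f + g) s = val f s + val g s := rfl

lemma val_smul (r : ℝ) (f : C(unitInterval, ℝ)) (s : ℝ) : val (r • f) s = r * val f s := rfl

lemma mellinKernel_zero_right (χ t : ℝ) : mellinKernel χ t 0 = 0 := by
  simp [mellinKernel]

lemma mellinOp_zero (χ : ℝ) (f : C(unitInterval, ℝ)) : mellinOp χ f 0 = 0 := by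
  simp [mellinOp, mellinKernel_zero_right]

lemma intervalIntegrable_mellinKernel_mul {χ s : ℝ} (hsin : Real.sin (χ * Real.pi) ≠ 0)
    (hs : 0 ≤ s) {f : ℝ → ℝ} (hf : Continuous f) :
    IntervalIntegrable (fun t => mellinKernel χ t s * f t) MeasureTheory.volume 0 1 := by
  rcases hs.eq_or_lt with rfl | hs
  · simp [mellinKernel_zero_right]
  · exact ((continuous_mellinKernel_left hsin hs).mul hf).intervalIntegrable _ _

lemma mellinOp_add {χ s : ℝ} (hsin : Real.sin (χ * Real.pi) ≠ 0) (hs : 0 ≤ s)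
    (f g : C(unitInterval, ℝ)) : mellinOp χ (f + g) s = mellinOp χ f s + mellinOp χ g s := by
  simp only [mellinOp, val_add, mul_add]
  exact intervalIntegral.integral_add
    (intervalIntegrable_mellinKernel_mul hsin hs (continuous_val f))
    (intervalIntegrable_mellinKernel_mul hsin hs (continuous_val g))

lemma mellinOp_smul (χ s r : ℝ) (f : C(unitInterval, ℝ)) :
    mellinOp χ (r • f) s = r * mellinOp χ f s := by
  simp only [mellinOp, val_smul, mul_left_comm _ r]
  exact intervalIntegral.integral_const_mul _ _

lemma mellinOpDiscrete_add (χ : ℝ) (m : ℕ) (f g : C(unitInterval, ℝ)) (s : ℝ) :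
    mellinOpDiscrete χ m (f + g) s = mellinOpDiscrete χ m f s + mellinOpDiscrete χ m g s := by
  simp only [mellinOpDiscrete, val_add, mul_add]
  exact lobatto_add _ _ _

lemma mellinOpDiscrete_smul (χ : ℝ) (m : ℕ) (r : ℝ) (f : C(unitInterval, ℝ)) (s : ℝ) :
    mellinOpDiscrete χ m (r • f) s = r * mellinOpDiscrete χ m f s := by
  simp only [mellinOpDiscrete, val_smul, mul_left_comm _ r]
  exact lobatto_const_mul _ _ _

lemma abs_mellinOp_le {χ s : ℝ} (h1 : -1 < χ) (h2 : χ < 1) (h0 : χ ≠ 0) (hs : 0 ≤ s)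
    (f : C(unitInterval, ℝ)) : |mellinOp χ f s| ≤ |χ| * Real.pi * ‖f‖ := by
  rcases hs.eq_or_lt with rfl | hs
  · rw [mellinOp_zero, abs_zero]
    have := Real.pi_pos
    positivity
  · exact abs_integral_mellinKernel_mul_le h1 h2 h0 hs (continuous_val f)
      fun t _ => abs_val_le f t

lemma continuousAt_mellinOpDiscrete {χ s : ℝ} (hsin : Real.sin (χ * Real.pi) ≠ 0) (hs : 0 < s)
    (m : ℕ) (f : C(unitInterval, ℝ)) : ContinuousAt (mellinOpDiscrete χ m f) s := by
  have hk : ∀ t, ContinuousAt (fun s => mellinKernel χ t s) s := fun t =>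
    ContinuousAt.div (by fun_prop) (by fun_prop) (kernel_denom_pos hsin hs t).ne'
  have h3 : ∀ t, ContinuousAt (fun s => mellinKernel χ t s * val f t) s :=
    fun t => (hk t).mul continuousAt_const
  unfold mellinOpDiscrete lobatto
  exact ((continuousAt_const.mul (h3 0)).add (tendsto_finsetSum _ fun y _ =>
    continuousAt_const.mul (h3 y))).add (continuousAt_const.mul (h3 1))

lemma continuousAt_mellinOp {χ s : ℝ} (hsin : Real.sin (χ * Real.pi) ≠ 0) (hs : 0 < s)
    (f : C(unitInterval, ℝ)) : ContinuousAt (mellinOp χ f) s := by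
  have hs2 : 0 < s / 2 := by positivity
  have hcont : Continuous fun x : ℝ =>
      ∫ t in (0 : ℝ)..1, mellinKernel χ t (max x (s / 2)) * val f t := by
    refine intervalIntegral.continuous_parametric_intervalIntegral_of_continuous'
      (f := fun x t => mellinKernel χ t (max x (s / 2)) * val f t) ?_ 0 1
    have hv : Continuous fun p : ℝ × ℝ => val f p.2 := (continuous_val f).comp continuous_snd
    unfold Function.uncurry mellinKernel
    refine Continuous.mul ?_ hv
    exact Continuous.div (by fun_prop) (by fun_prop) fun p =>
      (kernel_denom_pos hsin (lt_max_of_lt_right hs2) p.2).ne'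
  refine hcont.continuousAt.congr ?_
  filter_upwards [lt_mem_nhds (show s / 2 < s by linarith)] with x hx
  rw [max_eq_left hx.le, mellinOp]

lemma abs_mellinKernel_mul_le {χ s t : ℝ} (hsin : Real.sin (χ * Real.pi) ≠ 0) (hs : 0 < s)
    (ht : 0 ≤ t) : |mellinKernel χ t s * t| ≤ |Real.sin (χ * Real.pi)|⁻¹ := by
  have hden := kernel_denom_pos hsin hs t
  have hpos := abs_pos.2 hsin
  have hD : s * t * |Real.sin (χ * Real.pi)| ^ 2 ≤
      s ^ 2 + 2 * t * s * Real.cos (χ * Real.pi) + t ^ 2 := by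
    rw [sq_abs]
    have h3 := Real.sin_sq_add_cos_sq (χ * Real.pi)
    nlinarith [sq_nonneg (t + s * Real.cos (χ * Real.pi)),
      sq_nonneg (s + t * Real.cos (χ * Real.pi)),
      mul_nonneg (sq_nonneg (s - t)) (sq_nonneg (Real.sin (χ * Real.pi)))]
  rw [mellinKernel, div_mul_eq_mul_div, abs_div, abs_of_pos hden, div_le_iff₀ hden,
    abs_mul, abs_neg, abs_mul, abs_of_pos hs, abs_of_nonneg ht, inv_mul_eq_div, le_div_iff₀ hpos]
  linarith

lemma tendsto_integral_mellinKernel_mul_self {χ : ℝ} (hsin : Real.sin (χ * Real.pi) ≠ 0) :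
    Filter.Tendsto (fun s => ∫ t in (0 : ℝ)..1, |mellinKernel χ t s * t|)
      (nhdsWithin 0 (Set.Ioi 0)) (nhds 0) := by
  have h := intervalIntegral.tendsto_integral_filter_of_dominated_convergence
    (μ := MeasureTheory.volume) (a := (0 : ℝ)) (b := 1) (l := nhdsWithin (0 : ℝ) (Set.Ioi 0))
    (F := fun s t => |mellinKernel χ t s * t|) (f := fun _ => (0 : ℝ))
    (fun _ => |Real.sin (χ * Real.pi)|⁻¹) ?_ ?_ ?_ ?_
  · simpa using h
  · filter_upwards [self_mem_nhdsWithin] with s hs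
    exact ((continuous_mellinKernel_left hsin hs).mul continuous_id).abs.aestronglyMeasurable
  · filter_upwards [self_mem_nhdsWithin] with s hs
    refine Filter.Eventually.of_forall fun t ht => ?_
    rw [Set.uIoc_of_le zero_le_one] at ht
    rw [Real.norm_eq_abs, abs_abs]
    exact abs_mellinKernel_mul_le hsin hs ht.1.le
  · exact intervalIntegrable_const
  · refine Filter.Eventually.of_forall fun t ht => ?_
    rw [Set.uIoc_of_le zero_le_one] at ht
    have hk : ContinuousAt (fun s => |mellinKernel χ t s * t|) 0 := by
      refine (ContinuousAt.mul (ContinuousAt.div (by fun_prop) (by fun_prop) ?_)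
        continuousAt_const).abs
      have := ht.1.ne'
      simpa using this
    have h3 := hk.tendsto
    simp only [mellinKernel_zero_right, zero_mul, abs_zero] at h3
    exact h3.mono_left nhdsWithin_le_nhds

lemma tendsto_integral_mellinKernel {χ : ℝ} (h1 : -1 < χ) (h2 : χ < 1) (h0 : χ ≠ 0) :
    Filter.Tendsto (fun s => ∫ t in (0 : ℝ)..1, mellinKernel χ t s)
      (nhdsWithin 0 (Set.Ioi 0)) (nhds (-(χ * Real.pi))) := by
  have h3 : ContinuousAt (fun s : ℝ => Complex.arg (1 + kernelPole χ s) - χ * Real.pi) 0 := by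
    have h5 : ContinuousAt (fun s : ℝ => 1 + kernelPole χ s) 0 := by
      unfold kernelPole; fun_prop
    refine ContinuousAt.sub (ContinuousAt.comp' (f := fun s : ℝ => 1 + kernelPole χ s)
      (Complex.continuousAt_arg ?_) h5) continuousAt_const
    simp [kernelPole]
  have h4 := h3.tendsto
  simp only [kernelPole, Complex.ofReal_zero, zero_mul, add_zero, Complex.arg_one, zero_sub] at h4
  refine (h4.mono_left nhdsWithin_le_nhds).congr' ?_
  filter_upwards [self_mem_nhdsWithin] with s hs
  rw [integral_mellinKernel h1 h2 h0 hs, kernelPole]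

/-- As `s → 0`, the kernel `L(·, s)` concentrates at `0` and carries the mass `-χ π`. -/
lemma tendsto_mellinOp {χ : ℝ} (h1 : -1 < χ) (h2 : χ < 1) (h0 : χ ≠ 0)
    (f : C(unitInterval, ℝ)) :
    Filter.Tendsto (mellinOp χ f) (nhdsWithin 0 (Set.Ioi 0)) (nhds (-(χ * Real.pi) * f 0)) := by
  have hsin := sin_chi_ne_zero h1 h2 h0
  have hpi := Real.pi_pos
  have hrest : Filter.Tendsto (fun s => ∫ t in (0 : ℝ)..1, mellinKernel χ t s * (val f t - f 0))
      (nhdsWithin 0 (Set.Ioi 0)) (nhds 0) := by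
    rw [Metric.tendsto_nhds]
    intro η hη
    set η₁ := η / (2 * (|χ| * Real.pi + 1)) with hη₁
    have hη₁0 : 0 < η₁ := by positivity
    obtain ⟨d, hd, hd'⟩ := Metric.continuousAt_iff.1 (continuous_val f).continuousAt η₁ hη₁0
    have hbound : ∀ t ∈ Set.Icc (0 : ℝ) 1, |val f t - f 0| ≤ η₁ + 2 * ‖f‖ / d * t := by
      intro t ht
      rcases lt_or_ge t d with h | h
      · have := hd' (x := t) (by rwa [Real.dist_eq, sub_zero, abs_of_nonneg ht.1])
        rw [Real.dist_eq, val_zero] at this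
        have : 0 ≤ 2 * ‖f‖ / d * t := by have := ht.1; positivity
        linarith
      · have h3 : |val f t - f 0| ≤ 2 * ‖f‖ := by
          rw [← val_zero]
          have := abs_sub (val f t) (val f 0)
          linarith [abs_val_le f t, abs_val_le f 0]
        have h4 : 2 * ‖f‖ ≤ 2 * ‖f‖ / d * t := by
          rw [div_mul_eq_mul_div, le_div_iff₀ hd]
          gcongr
        linarith
    have hsmall := (tendsto_integral_mellinKernel_mul_self hsin).const_mul (2 * ‖f‖ / d)
    rw [mul_zero] at hsmall
    filter_upwards [self_mem_nhdsWithin, hsmall.eventually (gt_mem_nhds (half_pos hη))]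
      with s hs hs'
    have hk := continuous_mellinKernel_left hsin hs
    have hi1 : IntervalIntegrable (fun t => |mellinKernel χ t s| * η₁)
        MeasureTheory.volume 0 1 := (hk.abs.mul continuous_const).intervalIntegrable _ _
    have hi2 : IntervalIntegrable (fun t => 2 * ‖f‖ / d * |mellinKernel χ t s * t|)
        MeasureTheory.volume 0 1 :=
      (continuous_const.mul (hk.mul continuous_id).abs).intervalIntegrable _ _
    rw [Real.dist_eq, sub_zero]
    calc |∫ t in (0 : ℝ)..1, mellinKernel χ t s * (val f t - f 0)|
        ≤ ∫ t in (0 : ℝ)..1, |mellinKernel χ t s * (val f t - f 0)| :=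
          intervalIntegral.abs_integral_le_integral_abs zero_le_one
      _ ≤ ∫ t in (0 : ℝ)..1,
            (|mellinKernel χ t s| * η₁ + 2 * ‖f‖ / d * |mellinKernel χ t s * t|) := by
          refine intervalIntegral.integral_mono_on zero_le_one
            ((hk.mul ((continuous_val f).sub continuous_const)).abs.intervalIntegrable _ _)
            (hi1.add hi2) fun t ht => ?_
          rw [abs_mul, abs_mul, abs_of_nonneg ht.1]
          have := mul_le_mul_of_nonneg_left (hbound t ht) (abs_nonneg (mellinKernel χ t s))
          linarith
      _ = (∫ t in (0 : ℝ)..1, |mellinKernel χ t s|) * η₁ +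
            2 * ‖f‖ / d * ∫ t in (0 : ℝ)..1, |mellinKernel χ t s * t| := by
          rw [intervalIntegral.integral_add hi1 hi2,
            intervalIntegral.integral_mul_const, intervalIntegral.integral_const_mul]
      _ < |χ| * Real.pi * η₁ + η / 2 :=
          add_lt_add_of_le_of_lt (mul_le_mul_of_nonneg_right
            (integral_abs_mellinKernel_le h1 h2 h0 hs) hη₁0.le) hs'
      _ ≤ η := by
          have h3 : (|χ| * Real.pi + 1) * η₁ = η / 2 := by
            rw [hη₁]; field_simp
          linarith
  have h3 := ((tendsto_integral_mellinKernel h1 h2 h0).mul_const (f 0)).add hrest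
  rw [add_zero] at h3
  refine h3.congr' ?_
  filter_upwards [self_mem_nhdsWithin] with s hs
  have hs' : (0 : ℝ) ≤ s := (Set.mem_Ioi.1 hs).le
  rw [← intervalIntegral.integral_mul_const, ← intervalIntegral.integral_add
    (intervalIntegrable_mellinKernel_mul (f := fun _ => f 0) hsin hs' continuous_const)
    (intervalIntegrable_mellinKernel_mul (f := fun t => val f t - f 0) hsin hs'
      ((continuous_val f).sub continuous_const)), mellinOp]
  congr 1
  funext t
  ring

/-- Uniform convergence of the discretized operator to the right of the break points. By the
uniform bound for both operators it suffices to treat polynomials. -/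
lemma eventually_abs_mellinOpDiscrete_sub_le {χ c ε : ℝ} (h1 : -1 < χ) (h2 : χ < 1) (h0 : χ ≠ 0)
    (hc : 0 < c) (hε : 0 < ε) (hε' : ε < 1) (f : C(unitInterval, ℝ)) {η : ℝ} (hη : 0 < η) :
    ∀ᶠ m : ℕ in Filter.atTop, ∀ s, breakPoint c ε m ≤ s → s ≤ 1 →
      |mellinOpDiscrete χ m f s - mellinOp χ f s| ≤ η := by
  have hsin := sin_chi_ne_zero h1 h2 h0
  have hpi := Real.pi_pos
  set η₁ := η / (2 * (2 * (|χ| * Real.pi) + 1)) with hη₁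
  have hη₁0 : 0 < η₁ := by positivity
  obtain ⟨p, hp⟩ := exists_polynomial_near_of_continuousOn 0 1 (val f)
    (continuous_val f).continuousOn η₁ hη₁0
  set M := ‖f‖ + η₁ with hM
  have hpM : ∀ t ∈ Set.Icc (0 : ℝ) 1, |p.eval t| ≤ M := by
    intro t ht
    have h3 := abs_sub_abs_le_abs_sub (p.eval t) (val f t)
    linarith [hp t ht, abs_val_le f t]
  have hfp : ∀ t ∈ Set.Icc (0 : ℝ) 1, |val f t - p.eval t| ≤ η₁ := fun t ht => by
    rw [abs_sub_comm]; exact (hp t ht).le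
  have hE := tendsto_kernelError h1 h2 h0 hc hε hε'
  have hE1 := (hE.const_mul 2).eventually (ge_mem_nhds (show 2 * (0 : ℝ) < 1 by norm_num))
  have hE2 := (hE.mul_const M).eventually
    (ge_mem_nhds (show (0 : ℝ) * M < η / 4 by rw [zero_mul]; positivity))
  filter_upwards [hE1, hE2, Filter.eventually_ge_atTop 1, Filter.eventually_ge_atTop p.natDegree]
    with m hm1 hm2 hm hmp s hs hs1
  have hs0 : 0 < s := (breakPoint_pos hc hm).trans_le hs
  have e1 := abs_lobatto_mellinKernel_mul_le h1 h2 h0 hc hm hs hs1 hfp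
  have e2 := abs_lobatto_mellinKernel_mul_sub_le h1 h2 h0 hc hm hs hs1 hmp hpM
  have e3 := abs_integral_mellinKernel_mul_le (f := fun t => val f t - p.eval t) h1 h2 h0 hs0
    ((continuous_val f).sub p.continuous) hfp
  simp only [mul_sub] at e1 e3
  rw [lobatto_sub] at e1
  rw [intervalIntegral.integral_sub
    (intervalIntegrable_mellinKernel_mul hsin hs0.le (continuous_val f))
    (intervalIntegrable_mellinKernel_mul hsin hs0.le p.continuous)] at e3
  have h3 : (2 * (|χ| * Real.pi) + 1) * η₁ = η / 2 := by
    rw [hη₁]; field_simp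
  have h4 : 2 * kernelError χ c ε m * η₁ ≤ 1 * η₁ := mul_le_mul_of_nonneg_right hm1 hη₁0.le
  rw [abs_le] at e1 e2 e3 ⊢
  unfold mellinOpDiscrete mellinOp
  constructor <;> linarith [e1.1, e1.2, e2.1, e2.2, e3.1, e3.2]

/-! ### The operators on the space of triples -/

/-- A linear family of functions on `[0,1]` that is continuous, respects the matching condition at
`0` and is bounded by `B` defines a bounded operator of norm at most `B` on the space of triples. -/
lemma exists_continuousLinearMap (F : (Fin 3 → C(unitInterval, ℝ)) → ℝ → Fin 3 → ℝ) {B : ℝ}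
    (hB : 0 ≤ B)
    (hadd : ∀ ρ σ, ∀ s ∈ Set.Icc (0 : ℝ) 1, F (ρ + σ) s = F ρ s + F σ s)
    (hsmul : ∀ (r : ℝ) ρ, ∀ s ∈ Set.Icc (0 : ℝ) 1, F (r • ρ) s = r • F ρ s)
    (hcont : ∀ ρ ∈ spaceX, ∀ i, ContinuousOn (fun s => F ρ s i) (Set.Icc 0 1))
    (hmatch : ∀ ρ ∈ spaceX, F ρ 0 0 = F ρ 0 1)
    (hbound : ∀ ρ, ∀ s ∈ Set.Icc (0 : ℝ) 1, ∀ i, |F ρ s i| ≤ B * ‖ρ‖) :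
    ∃ T : spaceX →L[ℝ] spaceX,
      (∀ (ρ : spaceX) (s : unitInterval) (i : Fin 3),
        (T ρ : Fin 3 → C(unitInterval, ℝ)) i s = F ρ s i) ∧ ‖T‖ ≤ B := by
  let L : spaceX →ₗ[ℝ] spaceX :=
    { toFun := fun ρ => ⟨fun i => ⟨fun s => F ρ s i,
        continuousOn_iff_continuous_domRestrict.1 (hcont ρ ρ.2 i)⟩, hmatch ρ ρ.2⟩
      map_add' := fun ρ σ => by
        refine Subtype.ext (funext fun i => ContinuousMap.ext fun s => ?_)
        exact congrFun (hadd ρ σ s s.2) i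
      map_smul' := fun r ρ => by
        refine Subtype.ext (funext fun i => ContinuousMap.ext fun s => ?_)
        exact congrFun (hsmul r ρ s s.2) i }
  have hL : ∀ ρ, ‖L ρ‖ ≤ B * ‖ρ‖ := fun ρ => by
    have h0 : 0 ≤ B * ‖ρ‖ := mul_nonneg hB (norm_nonneg _)
    rw [Submodule.coe_norm, pi_norm_le_iff_of_nonneg h0]
    intro i
    rw [ContinuousMap.norm_le _ h0]
    exact fun s => hbound ρ s s.2 i
  exact ⟨L.mkContinuous B hL, fun ρ s i => rfl, L.mkContinuous_norm_le hB hL⟩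

lemma wedgeMatrix_add {χ s : ℝ} {A : C(unitInterval, ℝ) → ℝ → ℝ}
    (hA : ∀ f g, A (f + g) s = A f s + A g s) (ρ σ : Fin 3 → C(unitInterval, ℝ)) :
    wedgeMatrix χ A (ρ + σ) s = wedgeMatrix χ A ρ s + wedgeMatrix χ A σ s := by
  ext i
  fin_cases i
  · simp [wedgeMatrix, hA, val_add]; ring
  · simp [wedgeMatrix, hA, val_add]; ring
  · simp [wedgeMatrix]

lemma wedgeMatrix_smul {χ s r : ℝ} {A : C(unitInterval, ℝ) → ℝ → ℝ}
    (hA : ∀ f, A (r • f) s = r * A f s) (ρ : Fin 3 → C(unitInterval, ℝ)) :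
    wedgeMatrix χ A (r • ρ) s = r • wedgeMatrix χ A ρ s := by
  ext i
  fin_cases i
  · simp [wedgeMatrix, hA, val_smul]; ring
  · simp [wedgeMatrix, hA, val_smul]; ring
  · simp [wedgeMatrix]

lemma wedgeMatrix_of_pos (χ : ℝ) (A : C(unitInterval, ℝ) → ℝ → ℝ)
    (ρ : Fin 3 → C(unitInterval, ℝ)) {s : ℝ} (hs : 0 < s) :
    wedgeMatrix χ A ρ s = ![A (ρ 1) s, A (ρ 0) s, 0] := by
  simp [wedgeMatrix, angle, hs.ne']

lemma wedge_zero (χ : ℝ) (ρ : Fin 3 → C(unitInterval, ℝ)) :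
    wedge χ ρ 0 = ![-(χ * Real.pi) * ρ 0 0, -(χ * Real.pi) * ρ 1 0, 0] := by
  simp only [wedge, wedgeMatrix, angle, if_true, mellinOp_zero, val_zero]
  congr 1
  · ring
  · congr 1; ring

lemma abs_vec_le {a b B : ℝ} (hB : 0 ≤ B) (ha : |a| ≤ B) (hb : |b| ≤ B) (i : Fin 3) :
    |(![a, b, 0] : Fin 3 → ℝ) i| ≤ B := by
  fin_cases i
  · exact ha
  · exact hb
  · simpa using hB

lemma abs_wedge_zero_le (χ : ℝ) (ρ : Fin 3 → C(unitInterval, ℝ)) (i : Fin 3) :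
    |wedge χ ρ 0 i| ≤ |χ| * Real.pi * ‖ρ‖ := by
  have hpi := Real.pi_pos
  rw [wedge_zero]
  refine abs_vec_le (by positivity) ?_ ?_ i
  all_goals
    rw [abs_mul, abs_neg, abs_mul, abs_of_pos hpi]
    refine mul_le_mul_of_nonneg_left ?_ (by positivity)
    exact (ContinuousMap.norm_coe_le_norm _ _).trans (norm_le_pi_norm ρ _)

lemma abs_wedge_le {χ : ℝ} (h1 : -1 < χ) (h2 : χ < 1) (h0 : χ ≠ 0)
    (ρ : Fin 3 → C(unitInterval, ℝ)) {s : ℝ} (hs : 0 ≤ s) (i : Fin 3) :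
    |wedge χ ρ s i| ≤ |χ| * Real.pi * ‖ρ‖ := by
  rcases hs.eq_or_lt with rfl | hs
  · exact abs_wedge_zero_le χ ρ i
  have hpi := Real.pi_pos
  rw [wedge, wedgeMatrix_of_pos _ _ _ hs]
  refine abs_vec_le (by positivity) ?_ ?_ i
  all_goals
    refine (abs_mellinOp_le h1 h2 h0 hs.le _).trans ?_
    exact mul_le_mul_of_nonneg_left (norm_le_pi_norm ρ _) (by positivity)

lemma tendsto_vec {l : Filter ℝ} {f g : ℝ → ℝ} {a b : ℝ} (hf : Filter.Tendsto f l (nhds a))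
    (hg : Filter.Tendsto g l (nhds b)) (i : Fin 3) :
    Filter.Tendsto (fun s => (![f s, g s, 0] : Fin 3 → ℝ) i) l
      (nhds ((![a, b, 0] : Fin 3 → ℝ) i)) := by
  fin_cases i
  · exact hf
  · exact hg
  · exact tendsto_const_nhds

/-- The matching condition `ρ₁(0) = ρ₂(0)` makes the jump of the angle function compensate the
concentration of the kernel at `0`. -/
lemma continuousOn_wedge {χ : ℝ} (h1 : -1 < χ) (h2 : χ < 1) (h0 : χ ≠ 0)
    {ρ : Fin 3 → C(unitInterval, ℝ)} (hρ : ρ ∈ spaceX) (i : Fin 3) :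
    ContinuousOn (fun s => wedge χ ρ s i) (Set.Ici 0) := by
  have hsin := sin_chi_ne_zero h1 h2 h0
  intro s hs
  rcases (Set.mem_Ici.1 hs).eq_or_lt with rfl | hs
  · rw [← continuousWithinAt_Ioi_iff_Ici, ContinuousWithinAt, wedge_zero]
    have h01 : ρ 0 0 = ρ 1 0 := hρ
    have := tendsto_vec (tendsto_mellinOp h1 h2 h0 (ρ 1)) (tendsto_mellinOp h1 h2 h0 (ρ 0)) i
    rw [← h01] at this ⊢
    refine this.congr' ?_
    filter_upwards [self_mem_nhdsWithin] with x hx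
    rw [wedge, wedgeMatrix_of_pos _ _ _ hx]
  · refine ContinuousAt.continuousWithinAt ?_
    have := tendsto_vec (continuousAt_mellinOp hsin hs (ρ 1)).tendsto
      (continuousAt_mellinOp hsin hs (ρ 0)).tendsto i
    rw [ContinuousAt, wedge, wedgeMatrix_of_pos _ _ _ hs]
    refine this.congr' ?_
    filter_upwards [lt_mem_nhds hs] with x hx
    rw [wedge, wedgeMatrix_of_pos _ _ _ hx]

lemma exists_wedge_operator {χ : ℝ} (h1 : -1 < χ) (h2 : χ < 1) (h0 : χ ≠ 0) :
    ∃ W : spaceX →L[ℝ] spaceX, ∀ (ρ : spaceX) (s : unitInterval) (i : Fin 3),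
      (W ρ : Fin 3 → C(unitInterval, ℝ)) i s = wedge χ ρ s i := by
  have hsin := sin_chi_ne_zero h1 h2 h0
  have hpi := Real.pi_pos
  obtain ⟨W, hW, -⟩ := exists_continuousLinearMap (wedge χ) (B := |χ| * Real.pi) (by positivity)
    (fun ρ σ s hs => wedgeMatrix_add (fun f g => mellinOp_add hsin hs.1 f g) ρ σ)
    (fun r ρ s _ => wedgeMatrix_smul (fun f => mellinOp_smul χ s r f) ρ)
    (fun ρ hρ i => (continuousOn_wedge h1 h2 h0 hρ i).mono fun s hs => hs.1)
    (fun ρ hρ => by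
      have h01 : ρ 0 0 = ρ 1 0 := hρ
      simp [wedge_zero, h01])
    (fun ρ s hs i => abs_wedge_le h1 h2 h0 ρ hs.1 i)
  exact ⟨W, hW⟩

lemma wedgeModified_of_le {χ c ε s : ℝ} {m : ℕ} (hs : breakPoint c ε m ≤ s)
    (ρ : Fin 3 → C(unitInterval, ℝ)) :
    wedgeModified χ c ε m ρ s = wedgeDiscrete χ m ρ s := if_pos hs

lemma wedgeModified_of_lt {χ c ε s : ℝ} {m : ℕ} (hs : s < breakPoint c ε m)
    (ρ : Fin 3 → C(unitInterval, ℝ)) :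
    wedgeModified χ c ε m ρ s = (breakPoint c ε m)⁻¹ •
      (s • wedgeDiscrete χ m ρ (breakPoint c ε m) + (breakPoint c ε m - s) • wedge χ ρ 0) := by
  rw [wedgeModified, if_neg hs.not_ge]
  congr 1
  rw [breakPoint, inv_div]

lemma wedgeDiscrete_add (χ : ℝ) (m : ℕ) (ρ σ : Fin 3 → C(unitInterval, ℝ)) (s : ℝ) :
    wedgeDiscrete χ m (ρ + σ) s = wedgeDiscrete χ m ρ s + wedgeDiscrete χ m σ s :=
  wedgeMatrix_add (fun f g => mellinOpDiscrete_add χ m f g s) ρ σ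

lemma wedgeDiscrete_smul (χ : ℝ) (m : ℕ) (r : ℝ) (ρ : Fin 3 → C(unitInterval, ℝ)) (s : ℝ) :
    wedgeDiscrete χ m (r • ρ) s = r • wedgeDiscrete χ m ρ s :=
  wedgeMatrix_smul (fun f => mellinOpDiscrete_smul χ m r f s) ρ

lemma abs_wedgeDiscrete_le {χ c ε s : ℝ} (h1 : -1 < χ) (h2 : χ < 1) (h0 : χ ≠ 0) (hc : 0 < c)
    {m : ℕ} (hm : 1 ≤ m) (hs : breakPoint c ε m ≤ s) (hs1 : s ≤ 1)
    (ρ : Fin 3 → C(unitInterval, ℝ)) (i : Fin 3) :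
    |wedgeDiscrete χ m ρ s i| ≤ (|χ| * Real.pi + 2 * kernelError χ c ε m) * ‖ρ‖ := by
  have hpi := Real.pi_pos
  have hE := kernelError_nonneg (ε := ε) h1 h2 hc hm
  rw [wedgeDiscrete, wedgeMatrix_of_pos _ _ _ ((breakPoint_pos hc hm).trans_le hs)]
  refine abs_vec_le (by positivity) ?_ ?_ i
  all_goals
    exact abs_lobatto_mellinKernel_mul_le h1 h2 h0 hc hm hs hs1
      fun t _ => (abs_val_le _ t).trans (norm_le_pi_norm ρ _)

lemma abs_interpolate_le {δ s a b B : ℝ} (hδ : 0 < δ) (hs0 : 0 ≤ s) (hs : s ≤ δ) (ha : |a| ≤ B)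
    (hb : |b| ≤ B) : |δ⁻¹ * (s * a + (δ - s) * b)| ≤ B := by
  rw [abs_mul, abs_of_pos (inv_pos.2 hδ), inv_mul_le_iff₀ hδ]
  calc |s * a + (δ - s) * b| ≤ |s * a| + |(δ - s) * b| := abs_add_le _ _
    _ = s * |a| + (δ - s) * |b| := by
        rw [abs_mul, abs_mul, abs_of_nonneg hs0, abs_of_nonneg (sub_nonneg.2 hs)]
    _ ≤ s * B + (δ - s) * B := by
        have := sub_nonneg.2 hs
        gcongr
    _ = δ * B := by ring

lemma abs_wedgeModified_le {χ c ε s : ℝ} (h1 : -1 < χ) (h2 : χ < 1) (h0 : χ ≠ 0) (hc : 0 < c)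
    {m : ℕ} (hm : 1 ≤ m) (hδ1 : breakPoint c ε m ≤ 1) (hs : s ∈ Set.Icc (0 : ℝ) 1)
    (ρ : Fin 3 → C(unitInterval, ℝ)) (i : Fin 3) :
    |wedgeModified χ c ε m ρ s i| ≤ (|χ| * Real.pi + 2 * kernelError χ c ε m) * ‖ρ‖ := by
  rcases le_or_gt (breakPoint c ε m) s with h | h
  · rw [wedgeModified_of_le h]
    exact abs_wedgeDiscrete_le h1 h2 h0 hc hm h hs.2 ρ i
  · rw [wedgeModified_of_lt h]
    have hE := kernelError_nonneg (ε := ε) h1 h2 hc hm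
    refine abs_interpolate_le (breakPoint_pos hc hm) hs.1 h.le
      (abs_wedgeDiscrete_le h1 h2 h0 hc hm le_rfl hδ1 ρ i)
      ((abs_wedge_zero_le χ ρ i).trans ?_)
    exact mul_le_mul_of_nonneg_right (by linarith) (norm_nonneg _)

lemma continuous_wedgeModified {χ c ε : ℝ} (h1 : -1 < χ) (h2 : χ < 1) (h0 : χ ≠ 0) (hc : 0 < c)
    {m : ℕ} (hm : 1 ≤ m) (ρ : Fin 3 → C(unitInterval, ℝ)) (i : Fin 3) :
    Continuous fun s => wedgeModified χ c ε m ρ s i := by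
  have hsin := sin_chi_ne_zero h1 h2 h0
  have hδ := breakPoint_pos (ε := ε) hc hm
  have hcont : Continuous fun s => if breakPoint c ε m ≤ s then wedgeDiscrete χ m ρ s i
      else (breakPoint c ε m)⁻¹ * (s * wedgeDiscrete χ m ρ (breakPoint c ε m) i +
        (breakPoint c ε m - s) * wedge χ ρ 0 i) := by
    refine continuous_if_le continuous_const continuous_id ?_ (by fun_prop) ?_
    · intro s hs
      have hs0 : 0 < s := hδ.trans_le hs
      refine ContinuousAt.continuousWithinAt ?_
      have := tendsto_vec (continuousAt_mellinOpDiscrete hsin hs0 m (ρ 1)).tendsto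
        (continuousAt_mellinOpDiscrete hsin hs0 m (ρ 0)).tendsto i
      rw [ContinuousAt, wedgeDiscrete, wedgeMatrix_of_pos _ _ _ hs0]
      refine this.congr' ?_
      filter_upwards [lt_mem_nhds hs0] with x hx
      rw [wedgeDiscrete, wedgeMatrix_of_pos _ _ _ hx]
    · intro s hs
      rw [← hs]
      field_simp
      ring
  refine hcont.congr fun s => ?_
  split_ifs with h
  · rw [wedgeModified_of_le h]
  · rw [wedgeModified_of_lt (not_le.1 h)]
    simp

lemma wedgeModified_zero {χ c ε : ℝ} (hc : 0 < c) {m : ℕ} (hm : 1 ≤ m)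
    (ρ : Fin 3 → C(unitInterval, ℝ)) : wedgeModified χ c ε m ρ 0 = wedge χ ρ 0 := by
  have hδ := breakPoint_pos (ε := ε) hc hm
  rw [wedgeModified_of_lt hδ, zero_smul, zero_add, sub_zero, smul_smul, inv_mul_cancel₀ hδ.ne',
    one_smul]

lemma exists_wedgeModified_operator {χ c ε : ℝ} (h1 : -1 < χ) (h2 : χ < 1) (h0 : χ ≠ 0)
    (hc : 0 < c) {m : ℕ} (hm : 1 ≤ m) (hδ1 : breakPoint c ε m ≤ 1) :
    ∃ T : spaceX →L[ℝ] spaceX, (∀ (ρ : spaceX) (s : unitInterval) (i : Fin 3),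
      (T ρ : Fin 3 → C(unitInterval, ℝ)) i s = wedgeModified χ c ε m ρ s i) ∧
      ‖T‖ ≤ |χ| * Real.pi + 2 * kernelError χ c ε m := by
  have hsin := sin_chi_ne_zero h1 h2 h0
  have hpi := Real.pi_pos
  have hE := kernelError_nonneg (ε := ε) h1 h2 hc hm
  refine exists_continuousLinearMap (wedgeModified χ c ε m) (by positivity)
    (fun ρ σ s _ => ?_) (fun r ρ s _ => ?_)
    (fun ρ _ i => (continuous_wedgeModified h1 h2 h0 hc hm ρ i).continuousOn)
    (fun ρ hρ => ?_)
    (fun ρ s hs i => abs_wedgeModified_le h1 h2 h0 hc hm hδ1 hs ρ i)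
  · have hz : wedge χ (ρ + σ) 0 = wedge χ ρ 0 + wedge χ σ 0 :=
      wedgeMatrix_add (fun f g => mellinOp_add hsin le_rfl f g) ρ σ
    simp only [wedgeModified, wedgeDiscrete_add, hz]
    split_ifs
    · rfl
    · module
  · have hz : wedge χ (r • ρ) 0 = r • wedge χ ρ 0 :=
      wedgeMatrix_smul (fun f => mellinOp_smul χ 0 r f) ρ
    simp only [wedgeModified, wedgeDiscrete_smul, hz]
    split_ifs
    · rfl
    · module
  · have h01 : ρ 0 0 = ρ 1 0 := hρ
    rw [wedgeModified_zero hc hm]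
    simp [wedge_zero, h01]

/-- The triple `(1, 1, 0)` shows that the norm of each modified operator is at least `|χ| π`. -/
lemma abs_mul_pi_le_norm {χ c ε : ℝ} (hc : 0 < c) {m : ℕ} (hm : 1 ≤ m)
    {T : spaceX →L[ℝ] spaceX} (hT : ∀ (ρ : spaceX) (s : unitInterval) (i : Fin 3),
      (T ρ : Fin 3 → C(unitInterval, ℝ)) i s = wedgeModified χ c ε m ρ s i) :
    |χ| * Real.pi ≤ ‖T‖ := by
  have hpi := Real.pi_pos
  let ρ : spaceX := ⟨![1, 1, 0], rfl⟩
  have hρ : ‖ρ‖ ≤ 1 := by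
    rw [Submodule.coe_norm, pi_norm_le_iff_of_nonneg zero_le_one]
    intro i
    fin_cases i
    · exact norm_one.le
    · exact norm_one.le
    · simp [ρ]
  have hval : (T ρ : Fin 3 → C(unitInterval, ℝ)) 0 0 = -(χ * Real.pi) := by
    rw [hT, show ((0 : unitInterval) : ℝ) = 0 from rfl, wedgeModified_zero hc hm, wedge_zero]
    simp [ρ]
  calc |χ| * Real.pi = |(T ρ : Fin 3 → C(unitInterval, ℝ)) 0 0| := by
        rw [hval, abs_neg, abs_mul, abs_of_pos hpi]
    _ ≤ ‖(T ρ : Fin 3 → C(unitInterval, ℝ)) 0‖ :=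
        ((T ρ : Fin 3 → C(unitInterval, ℝ)) 0).norm_coe_le_norm 0
    _ ≤ ‖T ρ‖ := norm_le_pi_norm (T ρ : Fin 3 → C(unitInterval, ℝ)) 0
    _ ≤ ‖T‖ * ‖ρ‖ := T.le_opNorm ρ
    _ ≤ ‖T‖ := mul_le_of_le_one_right (norm_nonneg _) hρ

/-! ### Strong convergence -/

lemma tendsto_breakPoint (c : ℝ) {ε : ℝ} (hε' : ε < 1) :
    Filter.Tendsto (breakPoint c ε) Filter.atTop (nhds 0) :=
  ((tendsto_rpow_atTop (by linarith)).comp tendsto_natCast_atTop_atTop).const_div_atTop c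

lemma eventually_abs_wedgeDiscrete_sub_le {χ c ε : ℝ} (h1 : -1 < χ) (h2 : χ < 1) (h0 : χ ≠ 0)
    (hc : 0 < c) (hε : 0 < ε) (hε' : ε < 1) (ρ : Fin 3 → C(unitInterval, ℝ)) {η : ℝ}
    (hη : 0 < η) : ∀ᶠ m : ℕ in Filter.atTop, ∀ s, breakPoint c ε m ≤ s → s ≤ 1 →
      ∀ i, |wedgeDiscrete χ m ρ s i - wedge χ ρ s i| ≤ η := by
  filter_upwards [eventually_abs_mellinOpDiscrete_sub_le h1 h2 h0 hc hε hε' (ρ 0) hη,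
    eventually_abs_mellinOpDiscrete_sub_le h1 h2 h0 hc hε hε' (ρ 1) hη,
    Filter.eventually_ge_atTop 1] with m hm0 hm1 hm s hs hs1 i
  have hs0 : 0 < s := (breakPoint_pos hc hm).trans_le hs
  rw [wedgeDiscrete, wedge, wedgeMatrix_of_pos _ _ _ hs0, wedgeMatrix_of_pos _ _ _ hs0]
  fin_cases i
  · exact hm1 s hs hs1
  · exact hm0 s hs hs1
  · simpa using hη.le

lemma eventually_abs_wedgeModified_sub_le {χ c ε : ℝ} (h1 : -1 < χ) (h2 : χ < 1) (h0 : χ ≠ 0)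
    (hc : 0 < c) (hε : 0 < ε) (hε' : ε < 1) {ρ : Fin 3 → C(unitInterval, ℝ)} (hρ : ρ ∈ spaceX)
    {η : ℝ} (hη : 0 < η) : ∀ᶠ m : ℕ in Filter.atTop, ∀ s ∈ Set.Icc (0 : ℝ) 1,
      ∀ i, |wedgeModified χ c ε m ρ s i - wedge χ ρ s i| ≤ η := by
  have hnear : ∀ i, ∃ d > 0, ∀ s, 0 ≤ s → s < d → |wedge χ ρ s i - wedge χ ρ 0 i| < η / 4 := by
    intro i
    have := continuousOn_wedge h1 h2 h0 hρ i 0 (by simp)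
    obtain ⟨d, hd, hd'⟩ := Metric.continuousWithinAt_iff.1 this (η / 4) (by positivity)
    refine ⟨d, hd, fun s hs hsd => ?_⟩
    exact hd' hs (by rwa [Real.dist_eq, sub_zero, abs_of_nonneg hs])
  choose d hd hd' using hnear
  have hδd : ∀ᶠ m : ℕ in Filter.atTop, ∀ i, breakPoint c ε m < d i :=
    Filter.eventually_all.2 fun i => (tendsto_breakPoint c hε').eventually (gt_mem_nhds (hd i))
  filter_upwards [eventually_abs_wedgeDiscrete_sub_le h1 h2 h0 hc hε hε' ρ
    (show 0 < η / 4 by positivity), hδd, (tendsto_breakPoint c hε').eventually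
    (ge_mem_nhds zero_lt_one), Filter.eventually_ge_atTop 1] with m hm hmd hm1 hm0 s hs i
  have hδ := breakPoint_pos (ε := ε) hc hm0
  rcases le_or_gt (breakPoint c ε m) s with h | h
  · rw [wedgeModified_of_le h]
    linarith [hm s h hs.2 i]
  · rw [wedgeModified_of_lt h]
    set δ := breakPoint c ε m
    have hid : (δ⁻¹ • (s • wedgeDiscrete χ m ρ δ + (δ - s) • wedge χ ρ 0)) i - wedge χ ρ s i =
        δ⁻¹ * (s * (wedgeDiscrete χ m ρ δ i - wedge χ ρ s i) +
          (δ - s) * (wedge χ ρ 0 i - wedge χ ρ s i)) := by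
      simp only [Pi.smul_apply, Pi.add_apply, smul_eq_mul]
      field_simp
      ring
    rw [hid]
    have e1 := abs_le.1 (hm δ le_rfl hm1 i)
    have e2 := abs_lt.1 (hd' i δ hδ.le (hmd i))
    have e3 := abs_lt.1 (hd' i s hs.1 (h.trans (hmd i)))
    refine abs_interpolate_le hδ hs.1 h.le (abs_le.2 ⟨?_, ?_⟩) (abs_le.2 ⟨?_, ?_⟩) <;>
      linarith [e1.1, e1.2, e2.1, e2.2, e3.1, e3.2]

end LobattoWedge

end

theorem theorem3p2 (χ c ε : ℝ) (hχ : -1 < χ) (hχ' : χ < 1) (hχ0 : χ ≠ 0) (hc : 0 < c)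
    (hε : 0 < ε) (hε' : ε < 1) :
    ∃ (W : LobattoWedge.spaceX →L[ℝ] LobattoWedge.spaceX)
      (T : ℕ → LobattoWedge.spaceX →L[ℝ] LobattoWedge.spaceX),
      (∀ (ρ : LobattoWedge.spaceX) (s : unitInterval) (i : Fin 3),
        (W ρ : Fin 3 → C(unitInterval, ℝ)) i s = LobattoWedge.wedge χ ρ s i) ∧
      (∀ m : ℕ, 1 ≤ m → LobattoWedge.breakPoint c ε m ≤ 1 →
        ∀ (ρ : LobattoWedge.spaceX) (s : unitInterval) (i : Fin 3),
          (T m ρ : Fin 3 → C(unitInterval, ℝ)) i s =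
            LobattoWedge.wedgeModified χ c ε m ρ s i) ∧
      (∃ l : ℝ, Filter.Tendsto (fun m : ℕ => ‖T m‖) Filter.atTop (nhds l) ∧ l < Real.pi) ∧
      (∀ ρ : LobattoWedge.spaceX,
        Filter.Tendsto (fun m : ℕ => ‖(T m - W) ρ‖) Filter.atTop (nhds 0)) := by
  open LobattoWedge in
  obtain ⟨W, hW⟩ := exists_wedge_operator hχ hχ' hχ0
  have hex : ∀ m : ℕ, ∃ T : spaceX →L[ℝ] spaceX, 1 ≤ m → breakPoint c ε m ≤ 1 →
      (∀ (ρ : spaceX) (s : unitInterval) (i : Fin 3),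
        (T ρ : Fin 3 → C(unitInterval, ℝ)) i s = wedgeModified χ c ε m ρ s i) ∧
      ‖T‖ ≤ |χ| * Real.pi + 2 * kernelError χ c ε m := by
    intro m
    by_cases h : 1 ≤ m ∧ breakPoint c ε m ≤ 1
    · obtain ⟨T, hT⟩ := exists_wedgeModified_operator hχ hχ' hχ0 hc h.1 h.2
      exact ⟨T, fun _ _ => hT⟩
    -- The operators with break point beyond `1` are not prescribed.
    · exact ⟨0, fun h3 h4 => absurd ⟨h3, h4⟩ h⟩
  choose T hT using hex
  have hlarge : ∀ᶠ m : ℕ in Filter.atTop, 1 ≤ m ∧ breakPoint c ε m ≤ 1 :=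
    (Filter.eventually_ge_atTop 1).and
      ((tendsto_breakPoint c hε').eventually (ge_mem_nhds zero_lt_one))
  refine ⟨W, T, hW, fun m hm hδ => (hT m hm hδ).1, ⟨|χ| * Real.pi, ?_, ?_⟩, fun ρ => ?_⟩
  · have hup := ((tendsto_kernelError hχ hχ' hχ0 hc hε hε').const_mul 2).const_add (|χ| * Real.pi)
    rw [mul_zero, add_zero] at hup
    refine tendsto_of_tendsto_of_tendsto_of_le_of_le' tendsto_const_nhds hup ?_ ?_
    · filter_upwards [hlarge] with m hm
      exact abs_mul_pi_le_norm hc hm.1 (hT m hm.1 hm.2).1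
    · filter_upwards [hlarge] with m hm
      exact (hT m hm.1 hm.2).2
  · exact mul_lt_of_lt_one_left Real.pi_pos (abs_lt.2 ⟨hχ, hχ'⟩)
  · rw [Metric.tendsto_nhds]
    intro η hη
    filter_upwards [hlarge, eventually_abs_wedgeModified_sub_le hχ hχ' hχ0 hc hε hε' ρ.2
      (half_pos hη)] with m hm hclose
    rw [Real.dist_eq, sub_zero, abs_norm]
    refine lt_of_le_of_lt ?_ (half_lt_self hη)
    rw [Submodule.coe_norm, pi_norm_le_iff_of_nonneg (half_pos hη).le]
    intro i
    rw [ContinuousMap.norm_le _ (half_pos hη).le]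
    intro s
    have h3 : ((T m - W) ρ : Fin 3 → C(unitInterval, ℝ)) i s =
        wedgeModified χ c ε m ρ s i - wedge χ ρ s i := by
      rw [← (hT m hm.1 hm.2).1, ← hW]
      rfl
    rw [h3]
    exact hclose s s.2 i
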